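/- Let $\mathrm{Ai}$ be the Airy function, i.e. the entire function that continues $$\mathrm{Ai}(z)=\frac{\sqrt z}{3}\Big(I_{-1/3}\big(\tfrac23 z^{3/2}\big)-I_{1/3}\big(\tfrac23 z^{3/2}\big)\Big)\quad\big(z\neq0,\ |\arg z|<\tfrac{2\pi}{3}\big),\qquad I_\nu(z)=\Big(\frac z2\Big)^{\nu}\sum_{k=0}^\infty\frac{(z/2)^{2k}}{k!\,\Gamma(\nu+k+1)},$$ with principal powers. The order of an entire function $g$ is $\limsup_{r\to\infty}\dfrac{\log\log\max_{|z|\le r}|g(z)|}{\log r}$. Throughout, $\arg$ and $\sqrt{\ }$ are principal, with $\arg 0=0$. Then: 1. $\mathrm{Ai}$ is an entire function of order $\frac32$ all of whose zeros are negative real numbers, and $\mathrm{Ai}(z)\mathrm{Ai}(-z)$ is an even entire function of order $\frac32$ all of whose zeros are real. 2. $f(z)=\mathrm{Ai}(i\sqrt z)\,\mathrm{Ai}(-i\sqrt z)$ is an entire function of order $\frac34$ all of whose zeros are negative real numbers, and $$f(0)=\mathrm{Ai}(0)^2=\frac1{3^{4/3}\,\Gamma(2/3)^2}.$$ 3. The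 function $x\mapsto\log|\mathrm{Ai}(i\sqrt x)|$ is well defined (that is, $\mathrm{Ai}(i\sqrt x)\ne0$) and differentiable on $(0,\infty)$; for every real $\rho$ with $\frac34<\rho<1$ the function $x\mapsto x^{-\rho}\frac{d}{dx}\log|\mathrm{Ai}(i\sqrt x)|$ is Lebesgue integrable on $(0,\infty)$; and for every such $\rho$ and every $z\in\mathbb C$ with $|\arg z|<\frac\pi2$, $$\frac1{3^{4/3}\,\Gamma(2/3)^2}\le\big|\mathrm{Ai}(i\sqrt z)\,\mathrm{Ai}(-i\sqrt z)\big|\le\frac{\exp\big(b_\rho(z)\,|z|^\rho\big)}{3^{4/3}\,\Gamma(2/3)^2},$$ where $$b_\rho(z)=\frac{2(\rho/e)^\rho}{\cos^{1-\rho}(\arg z)\,\Gamma(1+\rho)}\int_0^\infty\frac{d}{dx}\log\big|\mathrm{Ai}(i\sqrt x)\big|\,\frac{dx}{x^\rho}.$$ -/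

import Mathlib

open Complex MeasureTheory Filter Set

/-- The entire function `w ↦ ∑ w ^ k / (k! Γ(ν + k + 1))`. -/
noncomputable def besselSeries (ν : ℝ) (w : ℂ) : ℂ :=
  ∑' k : ℕ, w ^ k / ((k.factorial : ℂ) * ((Real.Gamma (ν + k + 1) : ℝ) : ℂ))

/-- The Bessel function of the first kind,
`J_ν(z) = (z/2)^ν ∑ (-1)^k (z/2)^(2k) / (k! Γ(ν + k + 1))`, with the principal power. -/
noncomputable def besselJ (ν : ℝ) (z : ℂ) : ℂ :=
  (z / 2) ^ (ν : ℂ) * besselSeries ν (-(z / 2) ^ 2)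

/-- The modified Bessel function of the first kind,
`I_ν(z) = (z/2)^ν ∑ (z/2)^(2k) / (k! Γ(ν + k + 1))`, with the principal power. -/
noncomputable def besselI (ν : ℝ) (z : ℂ) : ℂ :=
  (z / 2) ^ (ν : ℂ) * besselSeries ν ((z / 2) ^ 2)

/-- The Airy function on the whole plane, as the analytic continuation of the expression
`(√z / 3) (I_{-1/3}(2/3 z^(3/2)) - I_{1/3}(2/3 z^(3/2)))`; see `airyAi_eq_besselI`. -/
noncomputable def airyAi (z : ℂ) : ℂ :=
  (((3 : ℝ) ^ (-(2 / 3) : ℝ) : ℝ) : ℂ) * besselSeries (-(1 / 3)) (z ^ 3 / 9)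
    - (((3 : ℝ) ^ (-(4 / 3) : ℝ) : ℝ) : ℂ) * z * besselSeries (1 / 3) (z ^ 3 / 9)

/-- The maximum modulus `max {|f(z)| : |z| ≤ r}`. -/
noncomputable def maxModulus (f : ℂ → ℂ) (r : ℝ) : ℝ :=
  sSup ((fun z => ‖f z‖) '' Metric.closedBall (0 : ℂ) r)

/-- The order `limsup_{r → ∞} log log max {|f(z)| : |z| ≤ r} / log r` of an entire function,
as an extended real number. -/
noncomputable def entireOrder (f : ℂ → ℂ) : EReal :=
  limsup (fun r : ℝ => ((Real.log (Real.log (maxModulus f r)) / Real.log r : ℝ) : EReal)) atTop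

/-- All zeros of `f` are negative real numbers. -/
def HasOnlyNegativeZeros (f : ℂ → ℂ) : Prop :=
  ∀ z : ℂ, f z = 0 → z.im = 0 ∧ z.re < 0

/-- The function `f(z) = Ai(i√z) Ai(-i√z)`. -/
noncomputable def airyProduct (z : ℂ) : ℂ :=
  airyAi (I * Complex.sqrt z) * airyAi (-(I * Complex.sqrt z))

/-- The coefficient `b_ρ(z)`. -/
noncomputable def airyBound (ρ : ℝ) (z : ℂ) : ℝ :=
  2 * (ρ / Real.exp 1) ^ ρ / (Real.cos z.arg ^ (1 - ρ) * Real.Gamma (1 + ρ)) *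
    ∫ x in Ioi (0 : ℝ),
      deriv (fun t : ℝ => Real.log ‖airyAi (I * ((Real.sqrt t : ℝ) : ℂ))‖) x / x ^ ρ

/-- `I_ν(z) = i^(-ν) J_ν(i z)` on the range of arguments on which it holds for principal powers. -/
theorem besselI_eq_besselJ (ν : ℝ) {z : ℂ} (hz : z ≠ 0) (h : z.arg ≤ Real.pi / 2) :
    besselI ν z = I ^ (-(ν : ℂ)) * besselJ ν (I * z) := by
  have hz2 : z / 2 ≠ 0 := by simp [hz]
  have harg : (z / 2).arg = z.arg := by
    have := arg_mul_real (r := 1 / 2) (by norm_num) z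
    rw [← this]; congr 1; push_cast; ring
  have h1 : (I * z / 2 : ℂ) = I * (z / 2) := by ring
  have hlog : log (I * (z / 2)) = log I + log (z / 2) := by
    rw [log_mul_eq_add_log_iff I_ne_zero hz2, harg, arg_I]
    constructor <;> linarith [neg_pi_lt_arg z, Real.pi_pos]
  unfold besselI besselJ
  rw [h1, cpow_def_of_ne_zero hz2, cpow_def_of_ne_zero I_ne_zero,
    cpow_def_of_ne_zero (mul_ne_zero I_ne_zero hz2), hlog, ← mul_assoc, ← exp_add]
  congr 2
  · ring
  · rw [mul_pow, I_sq]; ring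

/-- The definition of the Airy function through modified Bessel functions, on the sector where
the principal powers represent it. -/
theorem airyAi_eq_besselI {z : ℂ} (hz : z ≠ 0) (h : |z.arg| < 2 * Real.pi / 3) :
    airyAi z = Complex.sqrt z / 3 *
      (besselI (-(1 / 3)) (2 / 3 * z ^ (3 / 2 : ℂ)) - besselI (1 / 3) (2 / 3 * z ^ (3 / 2 : ℂ))) := by
  have hl3 : log (3 : ℂ) = (Real.log 3 : ℝ) := by
    rw [ofReal_log (by norm_num)]; norm_num
  have e3 : exp (log (3 : ℂ)) = 3 := exp_log (by norm_num)
  have key : 2 / 3 * z ^ (3 / 2 : ℂ) / 2 = exp (3 / 2 * log z - log 3) := by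
    rw [exp_sub, e3, cpow_def_of_ne_zero hz, mul_comm (log z)]; ring
  have him : (3 / 2 * log z - log (3 : ℂ)).im = 3 / 2 * z.arg := by
    rw [sub_im, hl3, ofReal_im, ← log_im,
      show (3 / 2 : ℂ) = ((3 / 2 : ℝ) : ℂ) by push_cast; rfl, im_ofReal_mul]
    ring
  have hlog : log (2 / 3 * z ^ (3 / 2 : ℂ) / 2) = 3 / 2 * log z - log 3 := by
    rw [key]
    apply log_exp <;> rw [him] <;> rw [abs_lt] at h <;> linarith [h.1, h.2]
  have hne : 2 / 3 * z ^ (3 / 2 : ℂ) / 2 ≠ 0 := by rw [key]; exact exp_ne_zero _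
  have hsq : (2 / 3 * z ^ (3 / 2 : ℂ) / 2) ^ 2 = z ^ 3 / 9 := by
    rw [key, ← exp_nat_mul, show ((2 : ℕ) : ℂ) * (3 / 2 * log z - log 3)
      = (3 : ℕ) * log z - (2 : ℕ) * log 3 by push_cast; ring, exp_sub, exp_nat_mul, exp_nat_mul,
      exp_log hz, e3]
    norm_num
  have hr (s : ℝ) : (((3 : ℝ) ^ s : ℝ) : ℂ) = exp (s * log 3) := by
    rw [Real.rpow_def_of_pos (by norm_num), hl3]; push_cast; rw [mul_comm]
  have hs : Complex.sqrt z / 3 = exp (1 / 2 * log z - log 3) := by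
    rw [Complex.sqrt, cpow_def_of_ne_zero hz, exp_sub, e3, mul_comm (log z)]; norm_num
  unfold airyAi besselI
  rw [hsq, cpow_def_of_ne_zero hne, cpow_def_of_ne_zero hne, hlog, hs, hr, hr, mul_sub,
    ← mul_assoc, ← mul_assoc, ← exp_add, ← exp_add]
  congr 2
  · congr 1; push_cast; ring
  · have hzz : ∀ a : ℂ, exp a * z = exp (a + log z) := fun a => by rw [exp_add, exp_log hz]
    rw [hzz]; congr 1; push_cast; ring

/-! The series defining `airyAi` is identified with a contour integral. Put L(w) = ∫₀^∞ exp(w r -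
r³/3) dr and let ω = exp(2πi/3). Integration by parts gives L'' = 1 + w L, so (ω L(ωz) - ω² L(ω²z))
/ (2πi) solves y'' = z y. Comparing Taylor coefficients, with the initial values given by Gamma
integrals, shows that it is Ai. The integral yields the growth bound exp(O(|z|^(3/2))) and the decay
of Ai along horizontal rays to the right.

If Ai(z) = 0, then W(t) = Ai'(z + t) · conj Ai(z + t) vanishes at t = 0 and as t → ∞, while W' = (z
+ t)|Ai|² + |Ai'|². The imaginary part of W' forces z to be real, the real part forces z < 0
(`hasOnlyNegativeZeros_airyAi`). The matching lower growth bound comes from the imaginary axis,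
where |Ai(iy)|² belongs to a closed system of nonnegative quantities that feed each other's growth
(`growth_of_cubic_system`). The two bounds give all three orders.

Let f be `airyProduct`. It has growth exponent 3/4 < 1 and only negative zeros -a, so f/f(0) is a
limit of finite products of factors 1 + z/a (`exists_tendsto_negProd`), and the bounds on |f| reduce
to one factor. For Re z ≥ 0 each factor has modulus at least 1, which is the lower bound. For the
upper bound, log|1 + z/a| is at most a constant times |z|^ρ ∫₀^∞ dx / ((x + a) x^ρ)
(`log_norm_one_add_div_le`). Summing over a turns Σ 1/(x + a) into (f'/f)(x), and since f(x) =
|Ai(i√x)|² for x > 0, this is twice the derivative of log|Ai(i√x)|. -/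

open scoped Topology

/-! ### Laplace integrals with cubic decay -/

/-- The Laplace-type integral `∫₀^∞ r ^ n exp (w r - r ^ 3 / 3) dr`. -/
noncomputable def airyLaplace (n : ℕ) (w : ℂ) : ℂ :=
  ∫ r in Ioi (0 : ℝ), (r : ℂ) ^ n * exp (w * r - r ^ 3 / 3)

/-- The gap between the two sides is `(r - s) ^ 2 * (r + 2 * s) / 3`; the exponent peaks at `r = s`.
-/
theorem sq_mul_sub_cube_le {r s : ℝ} (hr : 0 ≤ r) (hs : 0 ≤ s) :
    s ^ 2 * r - r ^ 3 / 3 ≤ 2 / 3 * s ^ 3 := by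
  nlinarith [mul_nonneg (sq_nonneg (r - s)) (by positivity : 0 ≤ r + 2 * s)]

theorem mul_sub_cube_le {c r : ℝ} (hr : 0 ≤ r) :
    c * r - r ^ 3 / 3 ≤ 2 / 3 * √(|c| + 1) ^ 3 - r := by
  -- Taking `s ^ 2 = |c| + 1` rather than `|c|` leaves the spare term `-r`, which makes the
  -- exponential integrable.
  have h := sq_mul_sub_cube_le hr (Real.sqrt_nonneg (|c| + 1))
  rw [Real.sq_sqrt (by positivity)] at h
  nlinarith [mul_le_mul_of_nonneg_right (le_abs_self c) hr]

theorem exp_mul_sub_cube_le {c r : ℝ} (hr : 0 ≤ r) :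
    Real.exp (c * r - r ^ 3 / 3) ≤ Real.exp (2 / 3 * √(|c| + 1) ^ 3) * Real.exp (-r) := by
  rw [← Real.exp_add]
  exact Real.exp_le_exp.2 (by linarith [mul_sub_cube_le (c := c) hr])

theorem integrableOn_pow_mul_exp_sub_cube (n : ℕ) (c : ℝ) :
    IntegrableOn (fun r : ℝ => r ^ n * Real.exp (c * r - r ^ 3 / 3)) (Ioi 0) := by
  have hi : IntegrableOn (fun r : ℝ => (n.factorial * Real.exp (2 / 3 * √(|c + 1| + 1) ^ 3)) *
      Real.exp (-r)) (Ioi 0) := by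
    have := (exp_neg_integrableOn_Ioi 0 one_pos).const_mul
      ((n.factorial : ℝ) * Real.exp (2 / 3 * √(|c + 1| + 1) ^ 3))
    simpa [IntegrableOn] using this
  refine hi.mono' (by fun_prop) ((ae_restrict_iff' measurableSet_Ioi).2 (ae_of_all _ ?_))
  intro r hr
  have hr : (0 : ℝ) < r := hr
  rw [Real.norm_of_nonneg (by positivity)]
  -- The power is traded for `exp r`, which shifts `c` to `c + 1`.
  have h1 : r ^ n ≤ n.factorial * Real.exp r := by
    have := Real.pow_div_factorial_le_exp r hr.le n
    rwa [div_le_iff₀ (by positivity), mul_comm] at this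
  have h2 := exp_mul_sub_cube_le (c := c + 1) hr.le
  calc r ^ n * Real.exp (c * r - r ^ 3 / 3)
      ≤ n.factorial * Real.exp r * Real.exp (c * r - r ^ 3 / 3) := by gcongr
    _ = n.factorial * Real.exp ((c + 1) * r - r ^ 3 / 3) := by
        rw [mul_assoc, ← Real.exp_add]; ring_nf
    _ ≤ n.factorial * (Real.exp (2 / 3 * √(|c + 1| + 1) ^ 3) * Real.exp (-r)) := by gcongr
    _ = _ := by ring

theorem norm_airyLaplace_integrand (n : ℕ) (w : ℂ) {r : ℝ} (hr : 0 ≤ r) :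
    ‖(r : ℂ) ^ n * exp (w * r - r ^ 3 / 3)‖ = r ^ n * Real.exp (w.re * r - r ^ 3 / 3) := by
  rw [norm_mul, norm_pow, norm_real, Real.norm_of_nonneg hr, norm_exp]
  congr 2
  rw [sub_re, re_mul_ofReal, show ((r : ℂ) ^ 3 / 3) = ((r ^ 3 / 3 : ℝ) : ℂ) by push_cast; rfl,
    ofReal_re]

theorem integrableOn_airyLaplace (n : ℕ) (w : ℂ) :
    IntegrableOn (fun r : ℝ => (r : ℂ) ^ n * exp (w * r - r ^ 3 / 3)) (Ioi 0) := by
  refine (integrableOn_pow_mul_exp_sub_cube n w.re).mono' (by fun_prop)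
    ((ae_restrict_iff' measurableSet_Ioi).2 (ae_of_all _ fun r hr => ?_))
  exact (norm_airyLaplace_integrand n w (le_of_lt hr)).le

theorem norm_airyLaplace_le (n : ℕ) (w : ℂ) :
    ‖airyLaplace n w‖ ≤ ∫ r in Ioi (0 : ℝ), r ^ n * Real.exp (w.re * r - r ^ 3 / 3) := by
  refine (norm_integral_le_integral_norm _).trans_eq (setIntegral_congr_fun measurableSet_Ioi ?_)
  exact fun r hr => norm_airyLaplace_integrand n w (le_of_lt hr)

theorem hasDerivAt_airyLaplace (n : ℕ) (w : ℂ) :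
    HasDerivAt (airyLaplace n) (airyLaplace (n + 1) w) w := by
  refine (hasDerivAt_integral_of_dominated_loc_of_deriv_le (𝕜 := ℂ)
    (μ := volume.restrict (Ioi (0 : ℝ)))
    (F := fun w (r : ℝ) => (r : ℂ) ^ n * exp (w * r - r ^ 3 / 3)) (Metric.ball_mem_nhds w one_pos)
    (bound := fun r : ℝ => r ^ (n + 1) * Real.exp ((w.re + 1) * r - r ^ 3 / 3))
    (F' := fun w (r : ℝ) => (r : ℂ) ^ (n + 1) * exp (w * r - r ^ 3 / 3))
    (Eventually.of_forall fun x => by fun_prop) (integrableOn_airyLaplace n w) (by fun_prop)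
    ?_ (integrableOn_pow_mul_exp_sub_cube _ _) ?_).2
  · refine (ae_restrict_iff' measurableSet_Ioi).2 (ae_of_all _ fun r hr x hx => ?_)
    have hr : (0 : ℝ) < r := hr
    rw [norm_airyLaplace_integrand _ _ hr.le]
    have : x.re ≤ w.re + 1 := by
      have h1 := abs_re_le_norm (x - w)
      rw [mem_ball_iff_norm] at hx
      rw [sub_re] at h1
      linarith [le_abs_self (x.re - w.re)]
    gcongr
  · refine ae_of_all _ fun r x _ => ?_
    have h : HasDerivAt (fun x : ℂ => x * r - r ^ 3 / 3) (r : ℂ) x := by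
      simpa using ((hasDerivAt_id x).mul_const (r : ℂ)).sub_const ((r : ℂ) ^ 3 / 3)
    refine (h.cexp.const_mul ((r : ℂ) ^ n)).congr_deriv ?_
    ring

/-- Integrate d/dr exp(w r - r³/3) = (w - r²) exp(w r - r³/3) over the half-line; the boundary value
at `r = 0` supplies the 1. Since differentiation in `w` raises the index, this is the equation L'' =
1 + w L. -/
theorem airyLaplace_two (w : ℂ) : airyLaplace 2 w = 1 + w * airyLaplace 0 w := by
  have hd : ∀ r ∈ Ici (0 : ℝ), HasDerivAt (fun r : ℝ => exp (w * r - r ^ 3 / 3))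
      (w * ((r : ℂ) ^ 0 * exp (w * r - r ^ 3 / 3)) - (r : ℂ) ^ 2 * exp (w * r - r ^ 3 / 3)) r := by
    intro r _
    have h : HasDerivAt (fun x : ℂ => w * x - x ^ 3 / 3) (w - (r : ℂ) ^ 2) r := by
      refine (((hasDerivAt_id (r : ℂ)).const_mul w).sub
        ((hasDerivAt_pow 3 (r : ℂ)).div_const 3)).congr_deriv ?_
      simp
    refine h.cexp.comp_ofReal.congr_deriv ?_
    ring
  have hlim : Tendsto (fun r : ℝ => exp (w * r - r ^ 3 / 3)) atTop (𝓝 0) := by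
    have h0 : Tendsto (fun r : ℝ => Real.exp (2 / 3 * √(|w.re| + 1) ^ 3) * Real.exp (-r)) atTop
        (𝓝 0) := by
      simpa using (Real.tendsto_exp_neg_atTop_nhds_zero).const_mul
        (Real.exp (2 / 3 * √(|w.re| + 1) ^ 3))
    refine squeeze_zero_norm' ?_ h0
    filter_upwards [eventually_ge_atTop 0] with r hr
    have := norm_airyLaplace_integrand 0 w hr
    rw [pow_zero, one_mul, pow_zero, one_mul] at this
    rw [this]
    exact exp_mul_sub_cube_le hr
  have i0 := (integrableOn_airyLaplace 0 w).const_mul w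
  have i2 := integrableOn_airyLaplace 2 w
  have key := integral_Ioi_of_hasDerivAt_of_tendsto' hd (i0.sub i2) hlim
  rw [integral_sub i0 i2, integral_const_mul] at key
  change w * airyLaplace 0 w - airyLaplace 2 w = _ at key
  simp at key
  linear_combination -key

theorem norm_airyLaplace_zero_le_exp (w : ℂ) :
    ‖airyLaplace 0 w‖ ≤ Real.exp (2 / 3 * √(‖w‖ + 1) ^ 3) := by
  refine (norm_airyLaplace_le 0 w).trans ?_
  have hi : IntegrableOn (fun r : ℝ => Real.exp (2 / 3 * √(|w.re| + 1) ^ 3) * Real.exp (-r))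
      (Ioi 0) := by
    have := (exp_neg_integrableOn_Ioi 0 one_pos).const_mul (Real.exp (2 / 3 * √(|w.re| + 1) ^ 3))
    simpa [IntegrableOn] using this
  calc _ ≤ ∫ r in Ioi (0 : ℝ), Real.exp (2 / 3 * √(|w.re| + 1) ^ 3) * Real.exp (-r) := by
        refine setIntegral_mono_on (integrableOn_pow_mul_exp_sub_cube 0 _) hi measurableSet_Ioi ?_
        intro r hr
        rw [pow_zero, one_mul]
        exact exp_mul_sub_cube_le (le_of_lt hr)
    _ = Real.exp (2 / 3 * √(|w.re| + 1) ^ 3) := by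
        rw [integral_const_mul, integral_exp_neg_Ioi]; simp
    _ ≤ _ := by
        have := abs_re_le_norm w
        gcongr

theorem norm_airyLaplace_zero_le_inv {w : ℂ} (hw : w.re < 0) :
    ‖airyLaplace 0 w‖ ≤ (-w.re)⁻¹ := by
  refine (norm_airyLaplace_le 0 w).trans ?_
  calc _ ≤ ∫ r in Ioi (0 : ℝ), Real.exp (w.re * r) := by
        refine setIntegral_mono_on (integrableOn_pow_mul_exp_sub_cube 0 _)
          (integrableOn_exp_mul_Ioi hw 0) measurableSet_Ioi ?_
        intro r hr
        have hr : (0 : ℝ) < r := hr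
        rw [pow_zero, one_mul]
        exact Real.exp_le_exp.2 (by have := pow_pos hr 3; linarith)
    _ = _ := by rw [integral_exp_mul_Ioi hw]; simp [inv_neg, neg_div]

theorem norm_airyLaplace_le_of_nonpos (n : ℕ) {w : ℂ} (hw : w.re ≤ 0) :
    ‖airyLaplace n w‖ ≤ ∫ r in Ioi (0 : ℝ), r ^ n * Real.exp (0 * r - r ^ 3 / 3) := by
  refine (norm_airyLaplace_le n w).trans ?_
  refine setIntegral_mono_on (integrableOn_pow_mul_exp_sub_cube n _)
    (integrableOn_pow_mul_exp_sub_cube n _) measurableSet_Ioi fun r hr => ?_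
  have hr : (0 : ℝ) < r := hr
  gcongr

theorem airyLaplace_apply_zero (n : ℕ) :
    airyLaplace n 0 = (((3 : ℝ) ^ (((n : ℝ) + 1) / 3 - 1) * Real.Gamma ((n + 1) / 3) : ℝ) : ℂ) := by
  have h := _root_.integral_rpow_mul_exp_neg_mul_rpow (p := 3) (q := n) (b := 1 / 3) (by norm_num)
    (by have : (0 : ℝ) ≤ n := n.cast_nonneg
        linarith) (by norm_num)
  have e : (1 / 3 : ℝ) ^ (-((n : ℝ) + 1) / 3) * (1 / 3) = (3 : ℝ) ^ (((n : ℝ) + 1) / 3 - 1) := by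
    rw [one_div, Real.inv_rpow (by norm_num), ← Real.rpow_neg (by norm_num),
      Real.rpow_sub_one (by norm_num), neg_div, neg_neg, div_eq_mul_inv (_ ^ _)]
  rw [e] at h
  rw [← h, ← integral_complex_ofReal, airyLaplace]
  refine setIntegral_congr_fun measurableSet_Ioi fun r hr => ?_
  have hr : (0 : ℝ) < r := hr
  have e3 : r ^ (3 : ℝ) = r ^ 3 := by exact_mod_cast Real.rpow_natCast r 3
  simp only [Real.rpow_natCast, e3]
  push_cast
  ring_nf

/-! ### Taylor coefficients of entire solutions of y'' = z y -/

theorem iteratedDeriv_id_mul {y : ℂ → ℂ} (hy : Differentiable ℂ y) (n : ℕ) :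
    iteratedDeriv (n + 1) (fun z => z * y z) =
      fun z => z * iteratedDeriv (n + 1) y z + (n + 1) * iteratedDeriv n y z := by
  have hd : ∀ m : ℕ, Differentiable ℂ (iteratedDeriv m y) := fun m =>
    (hy.contDiff (n := (m + 1 : ℕ))).differentiable_iteratedDeriv m
      (by exact_mod_cast Nat.lt_succ_self m)
  induction n with
  | zero =>
    ext z
    rw [iteratedDeriv_one, iteratedDeriv_one, iteratedDeriv_zero]
    refine ((hasDerivAt_id z).mul (hy z).hasDerivAt).deriv.trans ?_
    simp; ring
  | succ n ih =>
    ext z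
    rw [iteratedDeriv_succ, ih]
    have h1 : HasDerivAt (iteratedDeriv (n + 1) y) (iteratedDeriv (n + 2) y z) z := by
      rw [iteratedDeriv_succ (n := n + 1)]; exact (hd _ z).hasDerivAt
    have h0 : HasDerivAt (iteratedDeriv n y) (iteratedDeriv (n + 1) y z) z := by
      rw [iteratedDeriv_succ]; exact (hd _ z).hasDerivAt
    refine (((hasDerivAt_id z).mul h1).add (h0.const_mul ((n : ℂ) + 1))).deriv.trans ?_
    simp; ring

theorem iteratedDeriv_add_three_of_airy {y : ℂ → ℂ} (hy : Differentiable ℂ y)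
    (h : deriv (deriv y) = fun z => z * y z) (n : ℕ) :
    iteratedDeriv (n + 3) y 0 = (n + 1) * iteratedDeriv n y 0 := by
  rw [iteratedDeriv_succ', iteratedDeriv_succ', h, iteratedDeriv_id_mul hy]
  simp

/-- On indices of one residue class mod 3 the Airy recursion has order one, and its ratio is that of
the Bessel series in the variable z³/9: (3k+3)(3k+2) and (3k+4)(3k+3) equal 9(k+1)(ν+k+1) for ν =
-1/3 and ν = 1/3. -/
theorem besselSeries_coeff_of_rec {c : ℕ → ℂ} {ν : ℝ} (hν : -1 < ν) {C : ℂ}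
    (h0 : c 0 = C / (Real.Gamma (ν + 1) : ℝ))
    (h : ∀ k : ℕ, c (k + 1) * (9 * (k + 1) * (ν + k + 1)) = c k) (k : ℕ) :
    c k = C * ((1 / 9) ^ k / ((k.factorial : ℂ) * ((Real.Gamma (ν + k + 1) : ℝ) : ℂ))) := by
  induction k with
  | zero => rw [h0]; simp [div_eq_mul_inv]
  | succ k ih =>
    have hp : 0 < ν + k + 1 := by
      have : (0 : ℝ) ≤ k := k.cast_nonneg
      linarith
    have hpc : (ν + k + 1 : ℂ) ≠ 0 := by exact_mod_cast hp.ne'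
    have hk : (k + 1 : ℂ) ≠ 0 := by exact_mod_cast k.succ_ne_zero
    have hG : ((Real.Gamma (ν + k + 1) : ℝ) : ℂ) ≠ 0 := by
      exact_mod_cast (Real.Gamma_pos_of_pos hp).ne'
    have hf : (k.factorial : ℂ) ≠ 0 := by exact_mod_cast k.factorial_ne_zero
    have e := h k
    rw [ih] at e
    have hne : (9 * (k + 1) * (ν + k + 1) : ℂ) ≠ 0 := by
      exact mul_ne_zero (mul_ne_zero (by norm_num) hk) hpc
    rw [← eq_div_iff hne] at e
    rw [e, Nat.factorial_succ, show ν + ((k + 1 : ℕ) : ℝ) + 1 = (ν + k + 1) + 1 by push_cast; ring,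
      Real.Gamma_add_one hp.ne']
    push_cast
    field_simp
    ring

/-- An entire solution of the Airy equation is determined by its value and derivative at `0`. -/
theorem eq_besselSeries_of_airy {y : ℂ → ℂ} (hy : Differentiable ℂ y)
    (h : deriv (deriv y) = fun z => z * y z) (z : ℂ) :
    y z = y 0 * (Real.Gamma (2 / 3) : ℝ) * besselSeries (-(1 / 3)) (z ^ 3 / 9) +
      deriv y 0 * (Real.Gamma (4 / 3) : ℝ) * z * besselSeries (1 / 3) (z ^ 3 / 9) := by
  set c : ℕ → ℂ := fun n => iteratedDeriv n y 0 / n.factorial with hc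
  have hrec : ∀ n : ℕ, c (n + 3) * ((n + 3) * (n + 2)) = c n := by
    intro n
    have hf : (n.factorial : ℂ) ≠ 0 := by exact_mod_cast n.factorial_ne_zero
    have h1 : (n + 1 : ℂ) ≠ 0 := by exact_mod_cast (n.succ_ne_zero)
    have h2 : (n + 2 : ℂ) ≠ 0 := by exact_mod_cast (n + 1).succ_ne_zero
    have h3 : (n + 3 : ℂ) ≠ 0 := by exact_mod_cast (n + 2).succ_ne_zero
    simp only [hc]
    rw [iteratedDeriv_add_three_of_airy hy h]
    simp only [Nat.factorial_succ]
    push_cast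
    rw [show (n : ℂ) + 1 + 1 = n + 2 by ring, show (n : ℂ) + 2 + 1 = n + 3 by ring]
    field_simp
  -- The third residue class drops out because y''(0) = 0 · y(0).
  have h2 : ∀ k : ℕ, c (2 + 3 * k) = 0 := by
    intro k
    induction k with
    | zero =>
      simp [hc, iteratedDeriv_succ', iteratedDeriv_zero, h]
    | succ k ih =>
      have e := hrec (2 + 3 * k)
      rw [ih] at e
      have hne : (((2 + 3 * k : ℕ) : ℂ) + 3) * (((2 + 3 * k : ℕ) : ℂ) + 2) ≠ 0 := by
        norm_cast
      rw [show 2 + 3 * (k + 1) = 2 + 3 * k + 3 by ring]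
      exact (mul_eq_zero.1 e).resolve_right hne
  have hG2 : ((Real.Gamma (2 / 3) : ℝ) : ℂ) ≠ 0 := by
    exact_mod_cast (Real.Gamma_pos_of_pos (by norm_num)).ne'
  have hG4 : ((Real.Gamma (4 / 3) : ℝ) : ℂ) ≠ 0 := by
    exact_mod_cast (Real.Gamma_pos_of_pos (by norm_num)).ne'
  have c0 := besselSeries_coeff_of_rec (c := fun k => c (3 * k)) (ν := -(1 / 3)) (by norm_num)
    (C := y 0 * (Real.Gamma (2 / 3) : ℝ))
    (by rw [show (-(1 / 3) + 1 : ℝ) = 2 / 3 by norm_num, mul_div_cancel_right₀ _ hG2]; simp [hc])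
    (fun k => by
      rw [← hrec (3 * k), show 3 * (k + 1) = 3 * k + 3 by ring]
      push_cast; ring)
  have c1 := besselSeries_coeff_of_rec (c := fun k => c (1 + 3 * k)) (ν := 1 / 3) (by norm_num)
    (C := deriv y 0 * (Real.Gamma (4 / 3) : ℝ))
    (by
      rw [show (1 / 3 + 1 : ℝ) = 4 / 3 by norm_num, mul_div_cancel_right₀ _ hG4]
      simp [hc])
    (fun k => by
      rw [← hrec (1 + 3 * k), show 1 + 3 * (k + 1) = 1 + 3 * k + 3 by ring]
      push_cast; ring)
  have hs := hasSum_taylorSeries_of_entire hy 0 z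
  have hs' : HasSum (fun n : ℕ => c n * z ^ n) (y z) := by
    have e : (fun n : ℕ => c n * z ^ n) =
        fun n : ℕ => (n.factorial : ℂ)⁻¹ • (z - 0) ^ n • iteratedDeriv n y 0 := by
      ext n
      rw [hc, sub_zero, smul_eq_mul, smul_eq_mul]
      ring
    rwa [e]
  rw [← hs'.tsum_eq, Nat.sumByResidueClasses hs'.summable 3]
  change ∑ j : Fin 3, _ = _
  rw [Fin.sum_univ_three]
  have t0 : ∑' m : ℕ, c ((0 : ZMod 3).val + 3 * m) * z ^ ((0 : ZMod 3).val + 3 * m) =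
      y 0 * (Real.Gamma (2 / 3) : ℝ) * besselSeries (-(1 / 3)) (z ^ 3 / 9) := by
    rw [besselSeries, ← tsum_mul_left]
    refine tsum_congr fun m => ?_
    rw [ZMod.val_zero, zero_add, c0 m, pow_mul, div_pow, div_pow]
    ring
  have t1 : ∑' m : ℕ, c ((1 : ZMod 3).val + 3 * m) * z ^ ((1 : ZMod 3).val + 3 * m) =
      deriv y 0 * (Real.Gamma (4 / 3) : ℝ) * z * besselSeries (1 / 3) (z ^ 3 / 9) := by
    rw [besselSeries, ← tsum_mul_left]
    refine tsum_congr fun m => ?_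
    rw [show (1 : ZMod 3).val = 1 from rfl, c1 m, pow_add, pow_mul, div_pow, div_pow]
    ring
  have t2 : ∑' m : ℕ, c ((2 : ZMod 3).val + 3 * m) * z ^ ((2 : ZMod 3).val + 3 * m) = 0 := by
    refine (tsum_congr fun m => ?_).trans tsum_zero
    rw [show (2 : ZMod 3).val = 2 from rfl, h2 m, zero_mul]
  exact (congrArg₂ (· + ·) (congrArg₂ (· + ·) t0 t1) t2).trans (add_zero _)

/-! ### Contour representation of Ai -/

/-- The primitive cube root of unity `exp (2πi/3)`. -/
noncomputable def cubeRoot : ℂ := ⟨-1 / 2, √3 / 2⟩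

theorem cubeRoot_sq : cubeRoot ^ 2 = ⟨-1 / 2, -√3 / 2⟩ := by
  have h3 : √3 * √3 = 3 := Real.mul_self_sqrt (by norm_num)
  apply Complex.ext
  · simp [cubeRoot, sq]; linarith
  · simp [cubeRoot, sq]; ring

theorem cubeRoot_cube : cubeRoot ^ 3 = 1 := by
  have h3 : √3 * √3 = 3 := Real.mul_self_sqrt (by norm_num)
  rw [pow_succ, cubeRoot_sq]
  apply Complex.ext
  · simp [cubeRoot]; linarith
  · simp [cubeRoot]; ring

theorem cubeRoot_sub_sq : cubeRoot - cubeRoot ^ 2 = (√3 : ℝ) * I := by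
  rw [cubeRoot_sq]
  apply Complex.ext
  · simp [cubeRoot]
  · simp [cubeRoot]; ring

theorem norm_cubeRoot : ‖cubeRoot‖ = 1 := by
  have h := congrArg norm cubeRoot_cube
  rw [norm_pow, norm_one] at h
  exact (pow_eq_one_iff_of_nonneg (norm_nonneg _) (by norm_num)).1 h

/-- The contour integral of the Airy function along the rays of argument `π/6` and `5π/6`. -/
noncomputable def airyContour (z : ℂ) : ℂ :=
  (2 * Real.pi * I)⁻¹ * (cubeRoot * airyLaplace 0 (cubeRoot * z) -
    cubeRoot ^ 2 * airyLaplace 0 (cubeRoot ^ 2 * z))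

/-- The derivative of `airyContour`. -/
noncomputable def airyContourDeriv (z : ℂ) : ℂ :=
  (2 * Real.pi * I)⁻¹ * (cubeRoot ^ 2 * airyLaplace 1 (cubeRoot * z) -
    cubeRoot * airyLaplace 1 (cubeRoot ^ 2 * z))

theorem hasDerivAt_airyLaplace_mul (n : ℕ) (a z : ℂ) :
    HasDerivAt (fun z => airyLaplace n (a * z)) (airyLaplace (n + 1) (a * z) * a) z := by
  have h : HasDerivAt (fun z : ℂ => a * z) a z := by simpa using (hasDerivAt_id z).const_mul a
  exact (hasDerivAt_airyLaplace n (a * z)).comp z h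

theorem hasDerivAt_airyContour (z : ℂ) : HasDerivAt airyContour (airyContourDeriv z) z := by
  refine ((((hasDerivAt_airyLaplace_mul 0 cubeRoot z).const_mul cubeRoot).sub
    ((hasDerivAt_airyLaplace_mul 0 (cubeRoot ^ 2) z).const_mul (cubeRoot ^ 2))).const_mul
    (2 * Real.pi * I)⁻¹).congr_deriv ?_
  rw [airyContourDeriv]
  linear_combination (-(2 * Real.pi * I : ℂ)⁻¹ * airyLaplace 1 (cubeRoot ^ 2 * z) * cubeRoot) *
    cubeRoot_cube

/-- The second derivatives of both terms carry the factor ω³ = 1, so the inhomogeneous terms 1 of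
L'' = 1 + w L cancel in the difference. -/
theorem hasDerivAt_airyContourDeriv (z : ℂ) :
    HasDerivAt airyContourDeriv (z * airyContour z) z := by
  refine ((((hasDerivAt_airyLaplace_mul 1 cubeRoot z).const_mul (cubeRoot ^ 2)).sub
    ((hasDerivAt_airyLaplace_mul 1 (cubeRoot ^ 2) z).const_mul cubeRoot)).const_mul
    (2 * Real.pi * I)⁻¹).congr_deriv ?_
  simp only [Nat.reduceAdd]
  rw [airyContour, airyLaplace_two, airyLaplace_two]
  linear_combination (2 * Real.pi * I : ℂ)⁻¹ * z *
    (cubeRoot * airyLaplace 0 (cubeRoot * z) - cubeRoot ^ 2 * airyLaplace 0 (cubeRoot ^ 2 * z)) *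
    cubeRoot_cube

theorem Gamma_one_third_mul : Real.Gamma (1 / 3) * Real.Gamma (2 / 3) = 2 * Real.pi / √3 := by
  have h := Real.Gamma_mul_Gamma_one_sub (1 / 3)
  rw [show (1 - 1 / 3 : ℝ) = 2 / 3 by norm_num, show Real.pi * (1 / 3) = Real.pi / 3 by ring,
    Real.sin_pi_div_three] at h
  rw [h]; field_simp

theorem airyContour_zero : airyContour 0 * (Real.Gamma (2 / 3) : ℝ) =
    (((3 : ℝ) ^ (-(2 / 3) : ℝ) : ℝ) : ℂ) := by
  have h3 : √3 ≠ 0 := by positivity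
  have e := airyLaplace_apply_zero 0
  rw [show (((0 : ℕ) : ℝ) + 1) / 3 = 1 / 3 by norm_num,
    show (1 / 3 - 1 : ℝ) = -(2 / 3) by norm_num] at e
  have hpi : (Real.pi : ℂ) ≠ 0 := by exact_mod_cast Real.pi_ne_zero
  have e2 : airyContour 0 = ((√3 / (2 * Real.pi) : ℝ) : ℂ) * airyLaplace 0 0 := by
    rw [airyContour, mul_zero, mul_zero, ← sub_mul, cubeRoot_sub_sq]
    push_cast; field_simp
  rw [e2, e]
  norm_cast
  rw [show √3 / (2 * Real.pi) * ((3 : ℝ) ^ (-(2 / 3) : ℝ) * Real.Gamma (1 / 3)) *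
    Real.Gamma (2 / 3) = √3 / (2 * Real.pi) * (3 : ℝ) ^ (-(2 / 3) : ℝ) *
    (Real.Gamma (1 / 3) * Real.Gamma (2 / 3)) by ring, Gamma_one_third_mul]
  have := Real.pi_ne_zero
  field_simp

theorem airyContourDeriv_zero : airyContourDeriv 0 * (Real.Gamma (4 / 3) : ℝ) =
    -(((3 : ℝ) ^ (-(4 / 3) : ℝ) : ℝ) : ℂ) := by
  have h3 : √3 ≠ 0 := by positivity
  have e := airyLaplace_apply_zero 1
  rw [show (((1 : ℕ) : ℝ) + 1) / 3 = 2 / 3 by norm_num] at e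
  have hpi : (Real.pi : ℂ) ≠ 0 := by exact_mod_cast Real.pi_ne_zero
  have e2 : airyContourDeriv 0 = -((√3 / (2 * Real.pi) : ℝ) : ℂ) * airyLaplace 1 0 := by
    rw [airyContourDeriv, mul_zero, mul_zero, ← sub_mul, ← neg_sub, cubeRoot_sub_sq]
    push_cast; field_simp
  have h4 : Real.Gamma (4 / 3) = 1 / 3 * Real.Gamma (1 / 3) := by
    rw [← Real.Gamma_add_one (by norm_num)]; norm_num
  have h5 : (3 : ℝ) ^ (-(4 / 3) : ℝ) = (3 : ℝ) ^ (2 / 3 - 1 : ℝ) / 3 := by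
    rw [← Real.rpow_sub_one (by norm_num)]; norm_num
  rw [e2, e, h4, h5]
  norm_cast
  rw [show -(√3 / (2 * Real.pi)) * ((3 : ℝ) ^ (2 / 3 - 1 : ℝ) * Real.Gamma (2 / 3)) *
    (1 / 3 * Real.Gamma (1 / 3)) = -(√3 / (2 * Real.pi)) * (3 : ℝ) ^ (2 / 3 - 1 : ℝ) / 3 *
    (Real.Gamma (1 / 3) * Real.Gamma (2 / 3)) by ring, Gamma_one_third_mul]
  have := Real.pi_ne_zero
  field_simp

theorem airyAi_eq_airyContour : airyAi = airyContour := by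
  ext z
  have hd : deriv airyContour = airyContourDeriv := funext fun z => (hasDerivAt_airyContour z).deriv
  rw [eq_besselSeries_of_airy (fun z => (hasDerivAt_airyContour z).differentiableAt)
    (by rw [hd]; exact funext fun z => (hasDerivAt_airyContourDeriv z).deriv) z, hd,
    airyContour_zero, airyContourDeriv_zero, airyAi]
  ring

/-- The derivative of the Airy function. -/
noncomputable def airyAiDeriv (z : ℂ) : ℂ := airyContourDeriv z

theorem hasDerivAt_airyAi (z : ℂ) : HasDerivAt airyAi (airyAiDeriv z) z := by
  rw [airyAi_eq_airyContour]; exact hasDerivAt_airyContour z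

theorem hasDerivAt_airyAiDeriv (z : ℂ) : HasDerivAt airyAiDeriv (z * airyAi z) z := by
  rw [airyAi_eq_airyContour]; exact hasDerivAt_airyContourDeriv z

theorem differentiable_airyAi : Differentiable ℂ airyAi :=
  fun z => (hasDerivAt_airyAi z).differentiableAt

theorem airyAi_zero : airyAi 0 = (((3 : ℝ) ^ (-(2 / 3) : ℝ) / Real.Gamma (2 / 3) : ℝ) : ℂ) := by
  have hG2 : ((Real.Gamma (2 / 3) : ℝ) : ℂ) ≠ 0 := by
    exact_mod_cast (Real.Gamma_pos_of_pos (by norm_num)).ne'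
  rw [ofReal_div, eq_div_iff hG2, airyAi_eq_airyContour, airyContour_zero]

theorem airyAiDeriv_zero :
    airyAiDeriv 0 = ((-((3 : ℝ) ^ (-(4 / 3) : ℝ) / Real.Gamma (4 / 3)) : ℝ) : ℂ) := by
  have hG4 : ((Real.Gamma (4 / 3) : ℝ) : ℂ) ≠ 0 := by
    exact_mod_cast (Real.Gamma_pos_of_pos (by norm_num)).ne'
  rw [airyAiDeriv, ofReal_neg, ofReal_div, ← neg_div, eq_div_iff hG4, airyContourDeriv_zero]

/-! ### Zeros of Ai -/

theorem le_image_of_le_hasDerivAt {f f' : ℝ → ℝ} {a b m : ℝ} (hab : a ≤ b)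
    (hf : ∀ t, a ≤ t → HasDerivAt f (f' t) t) (hm : ∀ t, a ≤ t → m ≤ f' t) :
    f a + m * (b - a) ≤ f b := by
  have h := (convex_Ici a).mul_sub_le_image_sub_of_le_deriv (f := f) (C := m)
    (fun t ht => (hf t ht).continuousAt.continuousWithinAt)
    (fun t ht => (hf t (interior_subset ht)).differentiableAt.differentiableWithinAt)
    (fun t ht => by rw [(hf t (interior_subset ht)).deriv]; exact hm t (interior_subset ht))
    a self_mem_Ici b hab hab
  linarith

/-- A monotone function that starts at 0 and tends to 0 is identically 0. Applied to the real and
imaginary parts of W, it turns the sign of the derivative into a constraint on a zero of Ai. -/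
theorem hasDerivAt_eq_zero_of_tendsto_zero {φ φ' : ℝ → ℝ}
    (hφ : ∀ t, 0 ≤ t → HasDerivAt φ (φ' t) t) (hn : ∀ t, 0 ≤ t → 0 ≤ φ' t) (h0 : φ 0 = 0)
    (hlim : Tendsto φ atTop (𝓝 0)) {t : ℝ} (ht : 0 < t) : φ' t = 0 := by
  have hmono : ∀ a b, 0 ≤ a → a ≤ b → φ a ≤ φ b := fun a b ha hab => by
    have := le_image_of_le_hasDerivAt hab (fun t h => hφ t (ha.trans h))
      (fun t h => hn t (ha.trans h))
    linarith
  have hz : ∀ s, 0 ≤ s → φ s = 0 := by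
    intro s hs
    refine le_antisymm ?_ (h0 ▸ hmono 0 s le_rfl hs)
    refine ge_of_tendsto hlim ?_
    filter_upwards [eventually_ge_atTop s] with r hr using hmono s r hs hr
  have he : φ =ᶠ[𝓝 t] fun _ => 0 := by
    filter_upwards [lt_mem_nhds ht] with s hs using hz s hs.le
  exact ((hφ t ht.le).congr_of_eventuallyEq he.symm).unique (hasDerivAt_const t 0)

/-- Both ω and ω² have real part -1/2, so moving z to the right drives both arguments of L into the
left half-plane, where L is small. -/
theorem tendsto_re_cubeRoot_mul {a : ℂ} (ha : a.re = -1 / 2) (z : ℂ) :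
    Tendsto (fun t : ℝ => (a * (z + t)).re) atTop atBot := by
  have e : (fun t : ℝ => (a * (z + t)).re) = fun t : ℝ => (a * z).re + t * (-1 / 2) := by
    ext t
    rw [mul_add, add_re, re_mul_ofReal, ha, mul_comm t]
  rw [e]
  exact tendsto_atBot_add_const_left _ _ (tendsto_id.atTop_mul_const_of_neg (by norm_num))

theorem tendsto_airyLaplace_zero {a : ℂ} (ha : a.re = -1 / 2) (z : ℂ) :
    Tendsto (fun t : ℝ => airyLaplace 0 (a * (z + t))) atTop (𝓝 0) := by
  have h := tendsto_re_cubeRoot_mul ha z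
  refine squeeze_zero_norm' ?_ (tendsto_inv_atTop_zero.comp (tendsto_neg_atBot_atTop.comp h))
  filter_upwards [h.eventually_lt_atBot 0] with t ht using norm_airyLaplace_zero_le_inv ht

theorem cubeRoot_re : cubeRoot.re = -1 / 2 := rfl

theorem cubeRoot_sq_re : (cubeRoot ^ 2).re = -1 / 2 := by rw [cubeRoot_sq]

theorem norm_two_pi_I_inv : ‖(2 * Real.pi * I : ℂ)⁻¹‖ = (2 * Real.pi)⁻¹ := by
  rw [norm_inv, norm_mul, norm_mul, norm_I, norm_real, Real.norm_of_nonneg Real.pi_pos.le]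
  simp

theorem tendsto_airyAi (z : ℂ) : Tendsto (fun t : ℝ => airyAi (z + t)) atTop (𝓝 0) := by
  rw [airyAi_eq_airyContour]
  have := (((tendsto_airyLaplace_zero cubeRoot_re z).const_mul cubeRoot).sub
    ((tendsto_airyLaplace_zero cubeRoot_sq_re z).const_mul (cubeRoot ^ 2))).const_mul
    (2 * Real.pi * I)⁻¹
  simpa [airyContour] using this

theorem eventually_norm_airyAiDeriv_le (z : ℂ) :
    ∃ K, ∀ᶠ t : ℝ in atTop, ‖airyAiDeriv (z + t)‖ ≤ K := by
  set K := ∫ r in Ioi (0 : ℝ), r ^ 1 * Real.exp (0 * r - r ^ 3 / 3)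
  refine ⟨(2 * Real.pi)⁻¹ * (K + K), ?_⟩
  filter_upwards [(tendsto_re_cubeRoot_mul cubeRoot_re z).eventually_le_atBot 0,
    (tendsto_re_cubeRoot_mul cubeRoot_sq_re z).eventually_le_atBot 0] with t h1 h2
  rw [airyAiDeriv, airyContourDeriv, norm_mul, norm_two_pi_I_inv]
  have b1 := norm_airyLaplace_le_of_nonpos 1 h1
  have b2 := norm_airyLaplace_le_of_nonpos 1 h2
  gcongr
  refine (norm_sub_le _ _).trans ?_
  rw [norm_mul, norm_mul, norm_pow, norm_cubeRoot, one_pow, one_mul, one_mul]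
  exact add_le_add b1 b2

theorem airyAi_zero_re_pos : 0 < (3 : ℝ) ^ (-(2 / 3) : ℝ) / Real.Gamma (2 / 3) :=
  div_pos (by positivity) (Real.Gamma_pos_of_pos (by norm_num))

theorem airyAi_zero_ne_zero : airyAi 0 ≠ 0 := by
  rw [airyAi_zero]; exact_mod_cast airyAi_zero_re_pos.ne'

theorem exists_airyAi_add_ne_zero (z : ℂ) : ∃ t : ℝ, 0 < t ∧ airyAi (z + t) ≠ 0 := by
  by_contra! h
  have ha : AnalyticOnNhd ℂ airyAi univ := fun w _ => differentiable_airyAi.analyticAt w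
  have hf : ∃ᶠ w in 𝓝[≠] z, airyAi w = 0 := by
    have ht : Tendsto (fun t : ℝ => z + t) (𝓝[>] 0) (𝓝[≠] z) := by
      refine tendsto_nhdsWithin_iff.2 ⟨?_, ?_⟩
      · have : Continuous (fun t : ℝ => z + t) := by fun_prop
        simpa using (this.tendsto 0).mono_left nhdsWithin_le_nhds
      · filter_upwards [self_mem_nhdsWithin] with t ht
        have ht : (0 : ℝ) < t := ht
        simpa using ht.ne'
    refine ht.frequently (Eventually.frequently ?_)
    filter_upwards [self_mem_nhdsWithin] with t ht using h t ht
  have := ha.eqOn_zero_of_preconnected_of_frequently_eq_zero isPreconnected_univ (mem_univ z) hf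
  exact airyAi_zero_ne_zero (this (mem_univ 0))

/-- A Sturm–Liouville argument on the horizontal ray from a zero z: W = Ai' · conj Ai vanishes at
both ends, and y'' = z y makes W' = (z + t)|Ai|² + |Ai'|². -/
theorem hasOnlyNegativeZeros_airyAi : HasOnlyNegativeZeros airyAi := by
  intro z hz
  have hshift : ∀ t : ℝ, HasDerivAt (fun x : ℝ => z + (x : ℂ)) 1 t := fun t => by
    simpa using (ofRealCLM.hasDerivAt (x := t)).const_add z
  have hu : ∀ t : ℝ, HasDerivAt (fun x : ℝ => airyAi (z + x)) (airyAiDeriv (z + t)) t :=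
    fun t => (HasDerivAt.scomp (g₁ := airyAi) t (hasDerivAt_airyAi (z + t))
      (hshift t)).congr_deriv (one_smul _ _)
  have hv : ∀ t : ℝ, HasDerivAt (fun x : ℝ => airyAiDeriv (z + x)) ((z + t) * airyAi (z + t)) t :=
    fun t => ((hasDerivAt_airyAiDeriv (z + t)).scomp t (hshift t)).congr_deriv (one_smul _ _)
  set W : ℝ → ℂ := fun t => airyAiDeriv (z + t) * star (airyAi (z + t)) with hW
  have hW' : ∀ t : ℝ, HasDerivAt W
      ((z + t) * (‖airyAi (z + t)‖ ^ 2 : ℝ) + (‖airyAiDeriv (z + t)‖ ^ 2 : ℝ)) t := by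
    intro t
    refine ((hv t).mul (hu t).star).congr_deriv ?_
    have e : ∀ w : ℂ, ((‖w‖ ^ 2 : ℝ) : ℂ) = w * star w := fun w => by
      rw [star_def, mul_conj, normSq_eq_norm_sq]
    rw [e, e, mul_assoc]
  have h0 : W 0 = 0 := by simp [hW, hz]
  have hlim : Tendsto W atTop (𝓝 0) := by
    obtain ⟨K, hK⟩ := eventually_norm_airyAiDeriv_le z
    have hb := (tendsto_airyAi z).norm.const_mul K
    rw [norm_zero, mul_zero] at hb
    refine squeeze_zero_norm' ?_ hb
    filter_upwards [hK] with t ht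
    rw [hW, norm_mul, norm_star]
    gcongr
  obtain ⟨t, ht, hne⟩ := exists_airyAi_add_ne_zero z
  have hpos : 0 < ‖airyAi (z + t)‖ ^ 2 := by positivity
  have hre : ∀ t : ℝ, HasDerivAt (fun t => (W t).re)
      ((z.re + t) * ‖airyAi (z + t)‖ ^ 2 + ‖airyAiDeriv (z + t)‖ ^ 2) t := fun t => by
    have := reCLM.hasFDerivAt.comp_hasDerivAt t (hW' t)
    refine this.congr_deriv ?_
    rw [reCLM_apply, add_re, re_mul_ofReal, ofReal_re, add_re, ofReal_re]
  -- The factor `z.im` makes the derivative `z.im ^ 2 * ‖Ai‖ ^ 2`, nonnegative whatever the sign of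
  -- `z.im`.
  have him : ∀ t : ℝ, HasDerivAt (fun t => z.im * (W t).im)
      (z.im * (z.im * ‖airyAi (z + t)‖ ^ 2)) t := fun t => by
    have := (imCLM.hasFDerivAt.comp_hasDerivAt t (hW' t)).const_mul z.im
    refine this.congr_deriv ?_
    rw [imCLM_apply, add_im, im_mul_ofReal, ofReal_im, add_im, ofReal_im, add_zero, add_zero]
  have him0 : z.im = 0 := by
    have hl : Tendsto (fun t => z.im * (W t).im) atTop (𝓝 0) := by
      simpa using ((continuous_im.tendsto 0).comp hlim).const_mul z.im
    have := hasDerivAt_eq_zero_of_tendsto_zero (fun t _ => him t)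
      (fun t _ => by rw [← mul_assoc]; exact mul_nonneg (mul_self_nonneg _) (sq_nonneg _))
      (by simp [h0]) hl ht
    rw [← mul_assoc] at this
    exact mul_self_eq_zero.1 ((mul_eq_zero.1 this).resolve_right hpos.ne')
  refine ⟨him0, ?_⟩
  -- If `0 ≤ z.re`, both terms of the real part of W' are nonnegative for `t ≥ 0`, so W' would
  -- vanish where Ai does not.
  by_contra! hge
  have hl : Tendsto (fun t => (W t).re) atTop (𝓝 0) := (continuous_re.tendsto 0).comp hlim
  have := hasDerivAt_eq_zero_of_tendsto_zero (fun t _ => hre t)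
    (fun t ht => by positivity) (by simp [h0]) hl ht
  have h1 : 0 < (z.re + t) * ‖airyAi (z + t)‖ ^ 2 := mul_pos (by linarith) hpos
  have h2 := sq_nonneg ‖airyAiDeriv (z + t)‖
  linarith

/-! ### Upper growth bound and symmetry of Ai -/

theorem sqrt_add_one_cube_le {r : ℝ} (hr : 0 ≤ r) :
    √(r + 1) ^ 3 ≤ 4 * (1 + r ^ (3 / 2 : ℝ)) := by
  have e : r ^ (3 / 2 : ℝ) = √r ^ 3 := by
    rw [Real.sqrt_eq_rpow, ← Real.rpow_natCast, ← Real.rpow_mul hr]; norm_num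
  rw [e]
  have h1 : √(r + 1) ≤ √r + 1 := by
    refine Real.sqrt_le_iff.2 ⟨by positivity, ?_⟩
    nlinarith [Real.sq_sqrt hr, Real.sqrt_nonneg r]
  have h2 : √(r + 1) ^ 3 ≤ (√r + 1) ^ 3 := by gcongr
  nlinarith [mul_nonneg (sq_nonneg (√r - 1)) (by positivity : 0 ≤ √r + 1)]

theorem norm_airyAi_le (z : ℂ) :
    ‖airyAi z‖ ≤ Real.exp (8 / 3) * Real.exp (8 / 3 * ‖z‖ ^ (3 / 2 : ℝ)) := by
  have key : ‖airyAi z‖ ≤ Real.exp (2 / 3 * √(‖z‖ + 1) ^ 3) := by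
    set E := Real.exp (2 / 3 * √(‖z‖ + 1) ^ 3) with hE
    have b : ∀ a : ℂ, ‖a‖ = 1 → ‖a * airyLaplace 0 (a * z)‖ ≤ E := fun a ha => by
      have := norm_airyLaplace_zero_le_exp (a * z)
      rw [norm_mul, ha, one_mul] at this
      rwa [norm_mul, ha, one_mul]
    rw [airyAi_eq_airyContour, airyContour, norm_mul, norm_two_pi_I_inv]
    have h2 : ‖cubeRoot * airyLaplace 0 (cubeRoot * z) -
        cubeRoot ^ 2 * airyLaplace 0 (cubeRoot ^ 2 * z)‖ ≤ E + E :=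
      (norm_sub_le _ _).trans (add_le_add (b _ norm_cubeRoot)
        (b _ (by rw [norm_pow, norm_cubeRoot, one_pow])))
    calc _ ≤ (2 * Real.pi)⁻¹ * (E + E) := by gcongr
      _ = Real.pi⁻¹ * E := by field_simp; ring
      _ ≤ 1 * E := by
        gcongr
        exact inv_le_one_of_one_le₀ (by linarith [Real.pi_gt_three])
      _ = E := one_mul E
  refine key.trans ?_
  rw [← Real.exp_add]
  refine Real.exp_le_exp.2 ?_
  linarith [sqrt_add_one_cube_le (norm_nonneg z)]

theorem besselSeries_conj (ν : ℝ) (w : ℂ) :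
    besselSeries ν (star w) = star (besselSeries ν w) := by
  rw [besselSeries, besselSeries, tsum_star]
  refine tsum_congr fun k => ?_
  simp

theorem airyAi_conj (z : ℂ) : airyAi (star z) = star (airyAi z) := by
  have e : star z ^ 3 / 9 = star (z ^ 3 / 9) := by simp
  rw [airyAi, airyAi, e, besselSeries_conj, besselSeries_conj]
  simp

/-! ### Lower growth bound on the imaginary axis -/

/-- Growth of the nonnegative solutions of `F'' = 2 H`, `H' = 2 y G`, `G' = y F`. -/
theorem growth_of_cubic_system {F F₁ G H : ℝ → ℝ} (hF : ∀ y, HasDerivAt F (F₁ y) y)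
    (hF₁ : ∀ y, HasDerivAt F₁ (2 * H y) y) (hH : ∀ y, HasDerivAt H (2 * y * G y) y)
    (hG : ∀ y, HasDerivAt G (y * F y) y) (F10 : 0 ≤ F₁ 0) (G0 : 0 ≤ G 0)
    (Hn : ∀ y, 0 ≤ H y) (Fn : ∀ y, 0 ≤ F y) {s : ℝ} (hs : 0 < s) :
    F 0 * Real.exp (s ^ 3 / 4 - 1) ≤ F (2 * s ^ 2) := by
  have F1n : ∀ y, 0 ≤ y → 0 ≤ F₁ y := fun y hy => by
    have := le_image_of_le_hasDerivAt (m := 0) hy (fun t _ => hF₁ t)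
      (fun t _ => by have := Hn t; positivity)
    linarith
  have Gn : ∀ y, 0 ≤ y → 0 ≤ G y := fun y hy => by
    have := le_image_of_le_hasDerivAt (m := 0) hy (fun t _ => hG t)
      (fun t ht => mul_nonneg ht (Fn t))
    linarith
  have Fm : ∀ a b, 0 ≤ a → a ≤ b → F a ≤ F b := fun a b ha hab => by
    have := le_image_of_le_hasDerivAt (m := 0) hab (fun t _ => hF t)
      (fun t ht => F1n t (ha.trans ht))
    linarith
  have Gm : ∀ a b, 0 ≤ a → a ≤ b → G a ≤ G b := fun a b ha hab => by
    have := le_image_of_le_hasDerivAt (m := 0) hab (fun t _ => hG t)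
      (fun t ht => mul_nonneg (ha.trans ht) (Fn t))
    linarith
  have Hm : ∀ a b, 0 ≤ a → a ≤ b → H a ≤ H b := fun a b ha hab => by
    have := le_image_of_le_hasDerivAt (m := 0) hab (fun t _ => hH t)
      (fun t ht => mul_nonneg (by linarith) (Gn t (ha.trans ht)))
    linarith
  have F1m : ∀ a b, 0 ≤ a → a ≤ b → F₁ a ≤ F₁ b := fun a b ha hab => by
    have := le_image_of_le_hasDerivAt (m := 0) hab (fun t _ => hF₁ t)
      (fun t _ => by have := Hn t; positivity)
    linarith
  -- Four integrations, each over the next interval of length `h`, bound G, H, F₁ and F in turn from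
  -- below; monotonicity lets each integrand be replaced by its value at the left end.
  have step : ∀ y h, 0 ≤ y → 0 ≤ h → 4 * y ^ 2 * h ^ 4 * F y ≤ F (y + 4 * h) := by
    intro y h hy hh
    have g1 : y * F y * h ≤ G (y + h) := by
      have := le_image_of_le_hasDerivAt (a := y) (b := y + h) (m := y * F y) (by linarith)
        (fun t _ => hG t) (fun t ht => mul_le_mul ht (Fm _ _ hy ht) (Fn _) (hy.trans ht))
      have := Gn y hy
      linarith
    have g2 : 2 * y * G (y + h) * h ≤ H (y + 2 * h) := by
      have := le_image_of_le_hasDerivAt (a := y + h) (b := y + 2 * h) (m := 2 * y * G (y + h))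
        (by linarith) (fun t _ => hH t) (fun t ht => mul_le_mul (by linarith)
          (Gm _ _ (by linarith) ht) (Gn _ (by linarith)) (by linarith))
      have := Hn (y + h)
      linarith
    have g3 : 2 * H (y + 2 * h) * h ≤ F₁ (y + 3 * h) := by
      have := le_image_of_le_hasDerivAt (a := y + 2 * h) (b := y + 3 * h)
        (m := 2 * H (y + 2 * h)) (by linarith) (fun t _ => hF₁ t)
        (fun t ht => by have := Hm _ _ (by linarith) ht; linarith)
      have := F1n (y + 2 * h) (by linarith)
      linarith
    have g4 : F₁ (y + 3 * h) * h ≤ F (y + 4 * h) := by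
      have := le_image_of_le_hasDerivAt (a := y + 3 * h) (b := y + 4 * h)
        (m := F₁ (y + 3 * h)) (by linarith) (fun t _ => hF t)
        (fun t ht => F1m _ _ (by linarith) ht)
      have := Fn (y + 3 * h)
      linarith
    calc 4 * y ^ 2 * h ^ 4 * F y = 2 * (2 * y * (y * F y * h) * h) * h * h := by ring
      _ ≤ 2 * (2 * y * G (y + h) * h) * h * h := by gcongr
      _ ≤ 2 * H (y + 2 * h) * h * h := by gcongr
      _ ≤ F₁ (y + 3 * h) * h := by gcongr
      _ ≤ _ := g4
  -- With `h = s⁻¹` and `y ≥ s ^ 2` one has `y ^ 2 * h ^ 4 ≥ 1`, so F at least quadruples over each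
  -- length `4 / s`.
  have iter : ∀ k : ℕ, 4 ^ k * F (s ^ 2) ≤ F (s ^ 2 + 4 * k * s⁻¹) := by
    intro k
    induction k with
    | zero => simp
    | succ k ih =>
      set y := s ^ 2 + 4 * k * s⁻¹ with hy
      have hsy : s ^ 2 ≤ y := by
        have : 0 ≤ 4 * k * s⁻¹ := by positivity
        linarith
      have h4 : 4 ≤ 4 * y ^ 2 * s⁻¹ ^ 4 := by
        have : 4 * (s ^ 2) ^ 2 * s⁻¹ ^ 4 = 4 := by field_simp
        calc (4 : ℝ) = 4 * (s ^ 2) ^ 2 * s⁻¹ ^ 4 := this.symm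
          _ ≤ _ := by gcongr
      have e : s ^ 2 + 4 * ((k + 1 : ℕ) : ℝ) * s⁻¹ = y + 4 * s⁻¹ := by
        rw [hy]; push_cast; ring
      rw [e]
      calc 4 ^ (k + 1) * F (s ^ 2) = 4 * (4 ^ k * F (s ^ 2)) := by ring
        _ ≤ 4 * F y := by gcongr
        _ ≤ 4 * y ^ 2 * s⁻¹ ^ 4 * F y := by gcongr; exact Fn y
        _ ≤ _ := step _ _ (by positivity) (by positivity)
  -- This many steps of length `4 / s` fit into `[s ^ 2, 2 * s ^ 2]`. Rounding down costs the `-1`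
  -- in the exponent, and 4 is replaced by e.
  set k := ⌊s ^ 3 / 4⌋₊ with hk
  have hk1 : (k : ℝ) ≤ s ^ 3 / 4 := Nat.floor_le (by positivity)
  have hk2 : s ^ 3 / 4 < k + 1 := Nat.lt_floor_add_one _
  have hle : s ^ 2 + 4 * k * s⁻¹ ≤ 2 * s ^ 2 := by
    have : 4 * k * s⁻¹ ≤ 4 * (s ^ 3 / 4) * s⁻¹ := by gcongr
    have e : 4 * (s ^ 3 / 4) * s⁻¹ = s ^ 2 := by field_simp
    linarith
  calc F 0 * Real.exp (s ^ 3 / 4 - 1) ≤ F (s ^ 2) * Real.exp k := by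
        gcongr
        · exact Fn _
        · exact Fm _ _ le_rfl (by positivity)
        · linarith
    _ ≤ F (s ^ 2) * 4 ^ k := by
        have : Real.exp k ≤ 4 ^ k := by
          rw [← Real.exp_one_pow]
          gcongr
          linarith [Real.exp_one_lt_d9]
        gcongr
        exact Fn _
    _ = 4 ^ k * F (s ^ 2) := mul_comm _ _
    _ ≤ _ := iter k
    _ ≤ _ := Fm _ _ (by positivity) hle

theorem airyAi_zero_mul_deriv_zero_re_neg : (airyAiDeriv 0 * star (airyAi 0)).re < 0 := by
  rw [airyAi_zero, airyAiDeriv_zero, star_def, conj_ofReal, ← ofReal_mul, ofReal_re]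
  refine mul_neg_of_neg_of_pos (neg_neg_of_pos ?_) airyAi_zero_re_pos
  exact div_pos (by positivity) (Real.Gamma_pos_of_pos (by norm_num))

theorem airyAi_zero_mul_deriv_zero_im : (airyAiDeriv 0 * star (airyAi 0)).im = 0 := by
  rw [airyAi_zero, airyAiDeriv_zero, star_def, conj_ofReal, ← ofReal_mul, ofReal_im]

/-- With p(y) = Ai'(iy) · conj Ai(iy), the equation gives p' = -y|Ai|² - i|Ai'|². Hence F = |Ai|²,
F₁ = -2 Im p, H = |Ai'|², G = -Re p form the cubic system; F₁(0) = 0 and G(0) > 0 because Ai(0) > 0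
> Ai'(0). -/
theorem le_norm_airyAi_I_mul_sq {s : ℝ} (hs : 0 < s) :
    ‖airyAi 0‖ ^ 2 * Real.exp (s ^ 3 / 4 - 1) ≤ ‖airyAi (I * (2 * s ^ 2 : ℝ))‖ ^ 2 := by
  have hI : ∀ t : ℝ, HasDerivAt (fun x : ℝ => I * (x : ℂ)) I t := fun t => by
    simpa using (ofRealCLM.hasDerivAt (x := t)).const_mul I
  have hu : ∀ t : ℝ, HasDerivAt (fun x : ℝ => airyAi (I * x)) (I * airyAiDeriv (I * t)) t :=
    fun t => HasDerivAt.scomp (g₁ := airyAi) t (hasDerivAt_airyAi (I * t)) (hI t)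
  have hv : ∀ t : ℝ, HasDerivAt (fun x : ℝ => airyAiDeriv (I * x)) (-t * airyAi (I * t)) t :=
    fun t => ((hasDerivAt_airyAiDeriv (I * t)).scomp t (hI t)).congr_deriv (by
      rw [smul_eq_mul]; linear_combination (t * airyAi (I * t)) * I_mul_I)
  have e : ∀ w : ℂ, ((‖w‖ ^ 2 : ℝ) : ℂ) = w * star w := fun w => by
    rw [star_def, mul_conj, normSq_eq_norm_sq]
  have e' : ∀ w : ℂ, ‖w‖ ^ 2 = (w * star w).re := fun w => by rw [← e, ofReal_re]
  set p : ℝ → ℂ := fun y => airyAiDeriv (I * y) * star (airyAi (I * y)) with hp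
  have hp' : ∀ y : ℝ, HasDerivAt p
      (-(y * ‖airyAi (I * y)‖ ^ 2 : ℝ) - (‖airyAiDeriv (I * y)‖ ^ 2 : ℝ) * I) y := by
    intro y
    refine ((hv y).mul (hu y).star).congr_deriv ?_
    rw [ofReal_mul, e, e, star_mul', show star I = -I from conj_I]
    ring
  have hre : ∀ (g : ℝ → ℂ) (g' : ℂ) (y : ℝ), HasDerivAt g g' y →
      HasDerivAt (fun y => (g y).re) g'.re y := fun g g' y h =>
    reCLM.hasFDerivAt.comp_hasDerivAt y h
  have him : ∀ (g : ℝ → ℂ) (g' : ℂ) (y : ℝ), HasDerivAt g g' y →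
      HasDerivAt (fun y => (g y).im) g'.im y := fun g g' y h =>
    imCLM.hasFDerivAt.comp_hasDerivAt y h
  have := growth_of_cubic_system (F := fun y => ‖airyAi (I * y)‖ ^ 2)
    (F₁ := fun y => -2 * (p y).im) (G := fun y => -(p y).re)
    (H := fun y => ‖airyAiDeriv (I * y)‖ ^ 2) ?_ ?_ ?_ ?_ ?_ ?_
    (fun _ => sq_nonneg _) (fun _ => sq_nonneg _) hs
  · simpa using this
  · intro y
    simp only [e']
    refine (hre _ _ y ((hu y).mul (hu y).star)).congr_deriv ?_
    rw [hp]
    simp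
    ring
  · intro y
    refine ((him _ _ y (hp' y)).const_mul (-2)).congr_deriv ?_
    rw [sub_im, neg_im, ofReal_im, im_ofReal_mul, I_im]
    ring
  · intro y
    simp only [e']
    refine (hre _ _ y ((hv y).mul (hv y).star)).congr_deriv ?_
    rw [hp]
    simp
    ring
  · intro y
    refine (hre _ _ y (hp' y)).neg.congr_deriv ?_
    rw [sub_re, neg_re, ofReal_re, re_ofReal_mul, I_re]
    ring
  · rw [hp]
    simp only [ofReal_zero, mul_zero]
    rw [airyAi_zero_mul_deriv_zero_im, mul_zero]
  · rw [hp]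
    simp only [ofReal_zero, mul_zero]
    linarith [airyAi_zero_mul_deriv_zero_re_neg]

theorem le_norm_airyAi_I_mul_sq' {y : ℝ} (hy : 0 < y) :
    ‖airyAi 0‖ ^ 2 * Real.exp (-1) * Real.exp (1 / 12 * y ^ (3 / 2 : ℝ)) ≤
      ‖airyAi (I * y)‖ ^ 2 := by
  set s := √(y / 2) with hs
  have hsp : 0 < s := Real.sqrt_pos.2 (by positivity)
  have h := le_norm_airyAi_I_mul_sq hsp
  have e : 2 * s ^ 2 = y := by rw [hs, Real.sq_sqrt (by positivity)]; ring
  rw [e] at h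
  refine le_trans ?_ h
  rw [mul_assoc, ← Real.exp_add]
  gcongr
  have e2 : y ^ (3 / 2 : ℝ) = √2 ^ 3 * s ^ 3 := by
    rw [hs, ← mul_pow, ← Real.sqrt_mul (by norm_num), show 2 * (y / 2) = y by ring,
      Real.sqrt_eq_rpow, ← Real.rpow_natCast, ← Real.rpow_mul hy.le]
    norm_num
  -- For `y = 2 * s ^ 2` this gives `y ^ (3/2) ≤ 3 * s ^ 3`, the source of `1 / 12 = 1 / 4 / 3`.
  have e3 : √2 ^ 3 ≤ 3 := by
    have h1 : √2 * √2 = 2 := Real.mul_self_sqrt (by norm_num)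
    have h2 : √2 ≤ 1.5 := Real.sqrt_le_iff.2 ⟨by norm_num, by norm_num⟩
    nlinarith
  rw [e2]
  have := mul_le_mul_of_nonneg_right e3 (by positivity : 0 ≤ s ^ 3)
  linarith

theorem airyAi_neg_I_mul (y : ℝ) : airyAi (-(I * y)) = star (airyAi (I * y)) := by
  rw [← airyAi_conj]; congr 1; simp

/-! ### Order from two-sided growth bounds -/

theorem bddAbove_norm_image_closedBall {f : ℂ → ℂ} (hf : Continuous f) (r : ℝ) :
    BddAbove ((fun z => ‖f z‖) '' Metric.closedBall (0 : ℂ) r) :=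
  (isCompact_closedBall _ _).bddAbove_image hf.norm.continuousOn

theorem norm_le_maxModulus {f : ℂ → ℂ} (hf : Continuous f) {z : ℂ} {r : ℝ} (hz : ‖z‖ ≤ r) :
    ‖f z‖ ≤ maxModulus f r :=
  le_csSup (bddAbove_norm_image_closedBall hf r) ⟨z, by simpa using hz, rfl⟩

theorem maxModulus_le {f : ℂ → ℂ} {r B : ℝ} (hr : 0 ≤ r) (h : ∀ z, ‖z‖ ≤ r → ‖f z‖ ≤ B) :
    maxModulus f r ≤ B := by
  refine csSup_le ⟨_, 0, by simpa using hr, rfl⟩ ?_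
  rintro _ ⟨z, hz, rfl⟩
  exact h z (by simpa using hz)

/-- Two-sided exponential bounds of the maximum modulus determine the order. -/
theorem entireOrder_eq {f : ℂ → ℂ} (hf : Continuous f) {σ a A c C : ℝ} (hσ : 0 < σ) (ha : 0 < a)
    (hA : 0 < A) (hc : 0 < c) (hC : 0 < C)
    (hup : ∀ z, ‖f z‖ ≤ A * Real.exp (C * ‖z‖ ^ σ))
    (hlow : ∀ r : ℝ, 0 < r → ∃ z, ‖z‖ = r ∧ a * Real.exp (c * r ^ σ) ≤ ‖f z‖) :
    entireOrder f = ((σ : ℝ) : EReal) := by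
  refine Tendsto.limsup_eq ((continuous_coe_real_ereal.tendsto σ).comp ?_)
  have hpow : Tendsto (fun r : ℝ => r ^ σ) atTop atTop := tendsto_rpow_atTop hσ
  have hlog := Real.tendsto_log_atTop
  have hlo : Tendsto (fun r : ℝ => Real.log (c / 2) / Real.log r + σ) atTop (𝓝 σ) := by
    simpa using (hlog.const_div_atTop (Real.log (c / 2))).add_const σ
  have hhi : Tendsto (fun r : ℝ => Real.log (2 * C) / Real.log r + σ) atTop (𝓝 σ) := by
    simpa using (hlog.const_div_atTop (Real.log (2 * C))).add_const σ
  have e : ∀ {b r : ℝ}, 0 < b → 1 < r →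
      Real.log (b * r ^ σ) / Real.log r = Real.log b / Real.log r + σ := by
    intro b r hb hr
    have hr0 : 0 < r := by linarith
    rw [Real.log_mul hb.ne' (by positivity), Real.log_rpow hr0, add_div,
      mul_div_cancel_right₀ _ (Real.log_pos hr).ne']
  refine tendsto_of_tendsto_of_tendsto_of_le_of_le' hlo hhi ?_ ?_
  · filter_upwards [eventually_gt_atTop 1, hpow.eventually_ge_atTop (-Real.log a / (c / 2))]
      with r hr hrp
    have hr0 : 0 < r := by linarith
    obtain ⟨z, hz, hfz⟩ := hlow r hr0
    have hM : a * Real.exp (c * r ^ σ) ≤ maxModulus f r :=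
      hfz.trans (norm_le_maxModulus hf hz.le)
    -- For large `r` the constant `log a` costs at most half of the main term; `log A` is absorbed
    -- likewise below by doubling `C`.
    have h1 : c / 2 * r ^ σ ≤ Real.log (maxModulus f r) := by
      have := Real.log_le_log (by positivity) hM
      rw [Real.log_mul ha.ne' (Real.exp_pos _).ne', Real.log_exp] at this
      rw [div_le_iff₀ (by positivity)] at hrp
      linarith
    rw [← e (by positivity) hr]
    have := Real.log_pos hr
    have := Real.log_le_log (by positivity) h1
    gcongr
  · filter_upwards [eventually_gt_atTop 1, hpow.eventually_ge_atTop (Real.log A / C),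
      hpow.eventually_gt_atTop (-Real.log a / c)] with r hr hrp hrq
    have hr0 : 0 < r := by linarith
    obtain ⟨z, hz, hfz⟩ := hlow r hr0
    have hM0 : a * Real.exp (c * r ^ σ) ≤ maxModulus f r :=
      hfz.trans (norm_le_maxModulus hf hz.le)
    have hMp : 0 < maxModulus f r := lt_of_lt_of_le (by positivity) hM0
    have h0 : 0 < Real.log (maxModulus f r) := by
      have := Real.log_le_log (by positivity) hM0
      rw [Real.log_mul ha.ne' (Real.exp_pos _).ne', Real.log_exp] at this
      rw [div_lt_iff₀ hc] at hrq
      linarith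
    have hM : maxModulus f r ≤ A * Real.exp (C * r ^ σ) := by
      refine maxModulus_le hr0.le fun w hw => (hup w).trans ?_
      gcongr
    have h1 : Real.log (maxModulus f r) ≤ 2 * C * r ^ σ := by
      have := Real.log_le_log hMp hM
      rw [Real.log_mul hA.ne' (Real.exp_pos _).ne', Real.log_exp] at this
      rw [div_le_iff₀ hC] at hrp
      linarith
    rw [← e (by positivity) hr]
    have := Real.log_pos hr
    have := Real.log_le_log h0 h1
    gcongr

/-! ### The product f and the orders -/

theorem sqrt_sq_eq (z : ℂ) : Complex.sqrt z ^ 2 = z :=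
  cpow_nat_inv_pow z two_ne_zero

theorem I_mul_sqrt_sq (z : ℂ) : (I * Complex.sqrt z) ^ 2 = -z := by
  rw [mul_pow, I_sq, sqrt_sq_eq, neg_one_mul]

/-- Ai(w) Ai(-w) is even in w, so either square root of -z may be used. This is what removes the
branch cut. -/
theorem airyProduct_eq {w z : ℂ} (h : w ^ 2 = -z) : airyProduct z = airyAi w * airyAi (-w) := by
  rw [← I_mul_sqrt_sq, sq_eq_sq_iff_eq_or_eq_neg] at h
  rcases h with rfl | rfl
  · rfl
  · rw [neg_neg, mul_comm]; rfl

theorem differentiable_airyAi_mul_neg : Differentiable ℂ (fun w => airyAi w * airyAi (-w)) :=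
  differentiable_airyAi.mul (differentiable_airyAi.comp differentiable_neg)

theorem differentiableAt_airyProduct {z : ℂ} (hz : z ≠ 0) : DifferentiableAt ℂ airyProduct z := by
  -- A branch of the square root of -x holomorphic near `x = z`, also when z lies on the principal
  -- cut, since `x / z` is near 1.
  set s : ℂ → ℂ := fun x => I * (Complex.sqrt z * Complex.sqrt (x / z)) with hs
  have hsq : ∀ x, s x ^ 2 = -x := fun x => by
    rw [hs, mul_pow, mul_pow, I_sq, sqrt_sq_eq, sqrt_sq_eq, mul_div_cancel₀ _ hz, neg_one_mul]
  have he : airyProduct = fun x => airyAi (s x) * airyAi (-s x) :=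
    funext fun x => airyProduct_eq (hsq x)
  have h1 : DifferentiableAt ℂ Complex.sqrt (z / z) := by
    rw [div_self hz]; exact differentiableAt_sqrt one_mem_slitPlane
  have h2 : DifferentiableAt ℂ (fun x => Complex.sqrt (x / z)) z :=
    DifferentiableAt.comp (g := Complex.sqrt) (f := fun x => x / z) z h1
      (differentiableAt_fun_id.div_const z)
  have h3 : DifferentiableAt ℂ s z := (h2.const_mul _).const_mul _
  rw [he]
  exact (differentiable_airyAi_mul_neg (s z)).comp z h3

theorem differentiable_airyProduct : Differentiable ℂ airyProduct := by
  have hc : ContinuousAt airyProduct 0 := by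
    have h1 : ContinuousAt Complex.sqrt 0 := continuousAt_sqrt (by simp)
    exact (differentiable_airyAi_mul_neg.continuous.continuousAt).comp
      (f := fun z => I * Complex.sqrt z) (continuousAt_const.mul h1)
  refine differentiableOn_univ.1
    ((differentiableOn_compl_singleton_and_continuousAt_iff (c := 0) univ_mem).1 ⟨?_, hc⟩)
  exact fun z hz => (differentiableAt_airyProduct (by simpa using hz)).differentiableWithinAt

theorem hasOnlyNegativeZeros_airyProduct : HasOnlyNegativeZeros airyProduct := by
  have key : ∀ w z : ℂ, w ^ 2 = -z → airyAi w = 0 → z.im = 0 ∧ z.re < 0 := by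
    intro w z h hw
    obtain ⟨h1, h2⟩ := hasOnlyNegativeZeros_airyAi w hw
    have e : z = ((-w.re ^ 2 : ℝ) : ℂ) := by
      have : w = (w.re : ℂ) := Complex.ext rfl (by simpa using h1)
      rw [← neg_neg z, ← h, this]; simp
    rw [e]
    refine ⟨ofReal_im _, ?_⟩
    rw [ofReal_re]
    have := mul_pos_of_neg_of_neg h2 h2
    nlinarith
  intro z hz
  rcases mul_eq_zero.1 hz with h | h
  · exact key _ z (I_mul_sqrt_sq z) h
  · exact key _ z (by rw [neg_sq]; exact I_mul_sqrt_sq z) h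

theorem airyProduct_zero : airyProduct 0 = airyAi 0 ^ 2 := by
  rw [airyProduct_eq (w := 0) (by simp), neg_zero, sq]

theorem airyAi_zero_sq :
    airyAi 0 ^ 2 = ((1 / ((3 : ℝ) ^ (4 / 3 : ℝ) * Real.Gamma (2 / 3) ^ 2) : ℝ) : ℂ) := by
  rw [airyAi_zero, ← ofReal_pow, div_pow, ← Real.rpow_natCast _ 2, ← Real.rpow_mul (by norm_num)]
  rw [show (-(2 / 3) * ((2 : ℕ) : ℝ) : ℝ) = -(4 / 3) by norm_num, Real.rpow_neg (by norm_num)]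
  congr 1
  rw [one_div, mul_inv, div_eq_mul_inv]

theorem norm_airyAi_I_mul_sq (y : ℝ) :
    ‖airyAi (I * y) * airyAi (-(I * y))‖ = ‖airyAi (I * y)‖ ^ 2 := by
  rw [airyAi_neg_I_mul, norm_mul, norm_star, sq]

theorem norm_airyProduct_ofReal {t : ℝ} (ht : 0 ≤ t) :
    ‖airyProduct t‖ = ‖airyAi (I * (√t : ℝ))‖ ^ 2 := by
  rw [← norm_airyAi_I_mul_sq, airyProduct_eq (w := I * (√t : ℝ))]
  rw [mul_pow, I_sq, ← ofReal_pow, Real.sq_sqrt ht, neg_one_mul]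

theorem norm_airyAi_mul_neg_le (w : ℂ) : ‖airyAi w * airyAi (-w)‖ ≤
    Real.exp (16 / 3) * Real.exp (16 / 3 * ‖w‖ ^ (3 / 2 : ℝ)) := by
  have h1 := norm_airyAi_le w
  have h2 := norm_airyAi_le (-w)
  rw [norm_neg] at h2
  rw [norm_mul]
  refine (mul_le_mul h1 h2 (norm_nonneg _) (by positivity)).trans_eq ?_
  simp only [← Real.exp_add]
  congr 1; ring

theorem norm_airyProduct_le (z : ℂ) : ‖airyProduct z‖ ≤
    Real.exp (16 / 3) * Real.exp (16 / 3 * ‖z‖ ^ (3 / 4 : ℝ)) := by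
  have h := norm_airyAi_mul_neg_le (I * Complex.sqrt z)
  have e : ‖I * Complex.sqrt z‖ ^ (3 / 2 : ℝ) = ‖z‖ ^ (3 / 4 : ℝ) := by
    have := congrArg norm (I_mul_sqrt_sq z)
    rw [norm_pow, norm_neg] at this
    rw [← this, ← Real.rpow_natCast _ 2, ← Real.rpow_mul (norm_nonneg _)]
    norm_num
  rwa [e] at h

theorem entireOrder_airyAi : entireOrder airyAi = ((3 / 2 : ℝ) : EReal) := by
  have hp : 0 < ‖airyAi 0‖ * Real.exp (-1 / 2) :=
    mul_pos (norm_pos_iff.2 airyAi_zero_ne_zero) (Real.exp_pos _)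
  refine entireOrder_eq differentiable_airyAi.continuous (by norm_num) hp (Real.exp_pos _)
    (c := 1 / 24) (by norm_num) (by norm_num) norm_airyAi_le fun r hr => ⟨I * r, ?_, ?_⟩
  · rw [norm_mul, norm_I, one_mul, norm_real, Real.norm_of_nonneg hr.le]
  · refine le_of_sq_le_sq ?_ (norm_nonneg _)
    refine le_trans (le_of_eq ?_) (le_norm_airyAi_I_mul_sq' hr)
    rw [mul_pow, mul_pow, ← Real.exp_nat_mul, ← Real.exp_nat_mul]
    congr 2
    · congr 1; norm_num
    · push_cast; ring

theorem entireOrder_airyAi_mul_neg :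
    entireOrder (fun z => airyAi z * airyAi (-z)) = ((3 / 2 : ℝ) : EReal) := by
  have hp : 0 < ‖airyAi 0‖ ^ 2 * Real.exp (-1) :=
    mul_pos (pow_pos (norm_pos_iff.2 airyAi_zero_ne_zero) 2) (Real.exp_pos _)
  refine entireOrder_eq differentiable_airyAi_mul_neg.continuous (by norm_num) hp (Real.exp_pos _)
    (c := 1 / 12) (by norm_num) (by norm_num) norm_airyAi_mul_neg_le fun r hr => ⟨I * r, ?_, ?_⟩
  · rw [norm_mul, norm_I, one_mul, norm_real, Real.norm_of_nonneg hr.le]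
  · rw [norm_airyAi_I_mul_sq]
    exact le_norm_airyAi_I_mul_sq' hr

theorem entireOrder_airyProduct : entireOrder airyProduct = ((3 / 4 : ℝ) : EReal) := by
  have hp : 0 < ‖airyAi 0‖ ^ 2 * Real.exp (-1) :=
    mul_pos (pow_pos (norm_pos_iff.2 airyAi_zero_ne_zero) 2) (Real.exp_pos _)
  refine entireOrder_eq differentiable_airyProduct.continuous (by norm_num) hp (Real.exp_pos _)
    (c := 1 / 12) (by norm_num) (by norm_num) norm_airyProduct_le fun r hr => ⟨r, ?_, ?_⟩
  · rw [norm_real, Real.norm_of_nonneg hr.le]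
  · rw [norm_airyProduct_ofReal hr.le]
    have := le_norm_airyAi_I_mul_sq' (Real.sqrt_pos.2 hr)
    rwa [Real.sqrt_eq_rpow, ← Real.rpow_mul hr.le, ← Real.sqrt_eq_rpow,
      show (1 / 2 * (3 / 2) : ℝ) = 3 / 4 by norm_num] at this

theorem airyAi_I_mul_ne_zero {y : ℝ} (hy : 0 < y) : airyAi (I * y) ≠ 0 := by
  intro h
  have := (hasOnlyNegativeZeros_airyAi _ h).1
  rw [mul_comm, im_ofReal_mul, I_im, mul_one] at this
  exact hy.ne' this

/-! ### Factorization of entire functions of exponent less than 1 with negative zeros -/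

/-- The polynomial with value `1` at `0` and zeros `-a`, `a ∈ s`. -/
noncomputable def negProd (s : Multiset ℝ) (z : ℂ) : ℂ := (s.map fun a : ℝ => 1 + z / a).prod

@[simp] theorem negProd_empty (z : ℂ) : negProd 0 z = 1 := by simp [negProd]

@[simp] theorem negProd_cons (a : ℝ) (s : Multiset ℝ) (z : ℂ) :
    negProd (a ::ₘ s) z = (1 + z / a) * negProd s z := by simp [negProd]

@[simp] theorem negProd_apply_zero (s : Multiset ℝ) : negProd s 0 = 1 := by simp [negProd]

theorem differentiable_negProd (s : Multiset ℝ) : Differentiable ℂ (negProd s) := by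
  induction s using Multiset.induction with
  | empty => rw [show negProd 0 = fun _ => 1 from funext negProd_empty]; fun_prop
  | cons a s ih =>
    rw [show negProd (a ::ₘ s) = fun z => (1 + z / a) * negProd s z from
      funext (negProd_cons a s)]
    fun_prop

theorem pow_card_le_norm_negProd {s : Multiset ℝ} {z : ℂ} {b : ℝ} (hb : 0 ≤ b)
    (h : ∀ a ∈ s, b ≤ ‖1 + z / (a : ℂ)‖) : b ^ s.card ≤ ‖negProd s z‖ := by
  induction s using Multiset.induction with
  | empty => simp
  | cons a s ih =>
    rw [negProd_cons, Multiset.card_cons, pow_succ', norm_mul]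
    exact mul_le_mul (h a (Multiset.mem_cons_self a s))
      (ih fun a ha => h a (Multiset.mem_cons_of_mem ha)) (by positivity) (norm_nonneg _)

theorem le_norm_one_add_div {a b R : ℝ} {z : ℂ} (ha : 0 < a) (haR : a ≤ R) (hb : 0 ≤ b)
    (hz : (b + 1) * R ≤ ‖z‖) : b ≤ ‖1 + z / (a : ℂ)‖ := by
  have h1 : b + 1 ≤ ‖z / (a : ℂ)‖ := by
    rw [norm_div, norm_real, Real.norm_of_nonneg ha.le, le_div_iff₀ ha]
    refine le_trans ?_ hz
    gcongr
  have h2 := norm_sub_le (1 + z / (a : ℂ)) 1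
  rw [add_sub_cancel_left, norm_one] at h2
  linarith

theorem one_le_norm_one_add_div {a : ℝ} {z : ℂ} (ha : 0 < a) (hz : 0 ≤ z.re) :
    1 ≤ ‖1 + z / (a : ℂ)‖ := by
  refine le_trans ?_ (re_le_norm _)
  rw [add_re, one_re, div_ofReal_re]
  have : 0 ≤ z.re / a := by positivity
  linarith

theorem one_le_norm_negProd {s : Multiset ℝ} {z : ℂ} (hs : ∀ a ∈ s, 0 < a) (hz : 0 ≤ z.re) :
    1 ≤ ‖negProd s z‖ := by
  have := pow_card_le_norm_negProd (s := s) (z := z) zero_le_one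
    fun a ha => one_le_norm_one_add_div (hs a ha) hz
  rwa [one_pow] at this

/-- `f` is the product of `negProd s` and an entire function. -/
def NegProdDvd (s : Multiset ℝ) (f : ℂ → ℂ) : Prop :=
  ∃ g : ℂ → ℂ, Differentiable ℂ g ∧ ∀ z, f z = negProd s z * g z

theorem norm_le_of_sphere {g : ℂ → ℂ} (hg : Differentiable ℂ g) {R M : ℝ} (hR : 0 < R)
    (h : ∀ z, ‖z‖ = R → ‖g z‖ ≤ M) {z : ℂ} (hz : ‖z‖ ≤ R) : ‖g z‖ ≤ M := by
  refine norm_le_of_forall_mem_frontier_norm_le (U := Metric.ball 0 R) Metric.isBounded_ball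
    hg.diffContOnCl (fun w hw => h w ?_) ?_
  · rw [frontier_ball _ hR.ne'] at hw; simpa using hw
  · rw [closure_ball _ hR.ne']; simpa using hz

/-- A bound of the cofactor from a bound on a circle enclosing the zeros. -/
theorem pow_card_mul_norm_le {f g : ℂ → ℂ} (hg : Differentiable ℂ g) {s : Multiset ℝ}
    (hfg : ∀ z, f z = negProd s z * g z) {b R M : ℝ} (hb : 1 ≤ b) (hR : 0 < R)
    (hs : ∀ a ∈ s, 0 < a ∧ a ≤ R) (hM : ∀ z, ‖z‖ = (b + 1) * R → ‖f z‖ ≤ M) {z : ℂ}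
    (hz : ‖z‖ ≤ (b + 1) * R) : b ^ s.card * ‖g z‖ ≤ M := by
  have hp : 0 < b ^ s.card := by positivity
  have := norm_le_of_sphere hg (R := (b + 1) * R) (M := M / b ^ s.card) (by positivity) ?_ hz
  · rwa [le_div_iff₀ hp, mul_comm] at this
  · intro w hw
    rw [le_div_iff₀ hp, mul_comm]
    have h1 := pow_card_le_norm_negProd (s := s) (z := w) (by linarith : 0 ≤ b)
      fun a ha => le_norm_one_add_div (hs a ha).1 (hs a ha).2 (by linarith) hw.ge
    have h2 := hM w hw
    rw [hfg, norm_mul] at h2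
    exact (mul_le_mul_of_nonneg_right h1 (norm_nonneg _)).trans h2

theorem negProdDvd_cons_of_zero {f g : ℂ → ℂ} (hg : Differentiable ℂ g) {s : Multiset ℝ}
    (hfg : ∀ z, f z = negProd s z * g z) {a : ℝ} (ha : a ≠ 0) (hga : g (-a) = 0) :
    NegProdDvd (a ::ₘ s) f := by
  have ha' : (a : ℂ) ≠ 0 := by exact_mod_cast ha
  refine ⟨fun z => a * dslope g (-a) z, ?_, fun z => ?_⟩
  · refine Differentiable.const_mul ?_ _
    exact differentiableOn_univ.1 ((differentiableOn_dslope univ_mem).2 hg.differentiableOn)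
  · have h := sub_smul_dslope g (-a : ℂ) z
    rw [hga, sub_zero, smul_eq_mul] at h
    rw [hfg, negProd_cons, ← h]
    field_simp
    ring

/-- Any set of extracted zeros extends to one that exhausts the zeros in a disc. -/
theorem exists_negProd_mul {f : ℂ → ℂ} (hf : Differentiable ℂ f) (h0 : f 0 ≠ 0)
    (hneg : HasOnlyNegativeZeros f) {R : ℝ} (hR : 0 < R) {s : Multiset ℝ}
    (hs : ∀ a ∈ s, 0 < a ∧ a ≤ R) (hd : NegProdDvd s f) :
    ∃ t, s ≤ t ∧ (∀ a ∈ t, 0 < a ∧ a ≤ R) ∧ ∃ g : ℂ → ℂ, Differentiable ℂ g ∧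
      (∀ z, f z = negProd t z * g z) ∧ ∀ z, ‖z‖ ≤ R → g z ≠ 0 := by
  by_contra hno
  have grow : ∀ n : ℕ, ∃ t, s ≤ t ∧ (∀ a ∈ t, 0 < a ∧ a ≤ R) ∧ NegProdDvd t f ∧ n ≤ t.card := by
    intro n
    induction n with
    | zero => exact ⟨s, le_rfl, hs, hd, Nat.zero_le _⟩
    | succ n ih =>
      obtain ⟨t, hst, ht, ⟨g, hg, hfg⟩, hn⟩ := ih
      have : ∃ z, ‖z‖ ≤ R ∧ g z = 0 := by
        by_contra! h
        exact hno ⟨t, hst, ht, g, hg, hfg, h⟩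
      obtain ⟨z, hzR, hz⟩ := this
      obtain ⟨him, hre⟩ := hneg z (by rw [hfg, hz, mul_zero])
      have hza : z = -((-z.re : ℝ) : ℂ) := by
        apply Complex.ext <;> simp [him]
      refine ⟨-z.re ::ₘ t, hst.trans (Multiset.le_cons_self t _), ?_,
        negProdDvd_cons_of_zero hg hfg (by linarith) (by rw [← hza, hz]), ?_⟩
      · intro a ha
        rcases Multiset.mem_cons.1 ha with rfl | ha
        · exact ⟨by linarith, (neg_le_abs _).trans ((abs_re_le_norm z).trans hzR)⟩
        · exact ht a ha
      · rw [Multiset.card_cons]; omega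
  -- On the circle of radius `3 * R` every extracted factor has modulus at least 2, so the maximum
  -- principle gives `2 ^ card * ‖f 0‖ ≤ M`, which bounds the number of extracted zeros.
  obtain ⟨M, hM⟩ := (isCompact_sphere (0 : ℂ) ((2 + 1) * R)).exists_bound_of_continuousOn
    hf.continuous.continuousOn
  have h0' : 0 < ‖f 0‖ := norm_pos_iff.2 h0
  obtain ⟨n, hn⟩ := pow_unbounded_of_one_lt (M / ‖f 0‖) (one_lt_two)
  obtain ⟨t, -, ht, ⟨g, hg, hfg⟩, hcard⟩ := grow n
  have h1 := pow_card_mul_norm_le hg hfg (b := 2) one_le_two hR ht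
    (fun z hz => hM z (by simpa using hz)) (z := 0) (by rw [norm_zero]; positivity)
  have h2 : g 0 = f 0 := by rw [hfg, negProd_apply_zero, one_mul]
  rw [h2] at h1
  rw [div_lt_iff₀ h0'] at hn
  have h3 : (2 : ℝ) ^ n ≤ 2 ^ t.card := pow_le_pow_right₀ one_le_two hcard
  nlinarith

theorem exists_log_on_ball {g : ℂ → ℂ} (hg : Differentiable ℂ g) {R : ℝ} (hR : 0 < R)
    (hne : ∀ z, ‖z‖ ≤ R → g z ≠ 0) : ∃ h : ℂ → ℂ, DifferentiableOn ℂ h (Metric.ball 0 R) ∧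
      h 0 = 0 ∧ ∀ z ∈ Metric.ball (0 : ℂ) R, g z = g 0 * exp (h z) := by
  have hne' : ∀ z ∈ Metric.ball (0 : ℂ) R, g z ≠ 0 := fun z hz =>
    hne z (by simpa using (Metric.mem_ball.1 hz).le)
  have hd : DifferentiableOn ℂ (fun z => deriv g z / g z) (Metric.ball 0 R) :=
    hg.deriv.differentiableOn.div hg.differentiableOn hne'
  obtain ⟨h, h0, hh⟩ := hd.isExactOn_ball.with_val_at 0 0
  refine ⟨h, fun z hz => (hh z hz).differentiableAt.differentiableWithinAt, h0, fun z hz => ?_⟩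
  have hder : ∀ w ∈ Metric.ball (0 : ℂ) R, HasDerivAt (fun w => g w * exp (-h w)) 0 w := by
    intro w hw
    refine ((hg w).hasDerivAt.mul (hh w hw).neg.cexp).congr_deriv ?_
    have := hne' w hw
    field_simp
    ring
  have hconst := Metric.isOpen_ball.is_const_of_deriv_eq_zero
    (convex_ball (0 : ℂ) R).isPreconnected
    (fun w hw => (hder w hw).differentiableAt.differentiableWithinAt)
    (fun w hw => (hder w hw).deriv) hz (Metric.mem_ball_self hR)
  simp only [h0, neg_zero, exp_zero, mul_one] at hconst
  rw [← hconst, mul_assoc, ← exp_add, neg_add_cancel, exp_zero, mul_one]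

/-- The cofactor is f(0) exp(h) on the disc of radius R. On `‖z‖ = 2 * R` each factor has modulus at
least 1, so the bound on f passes to the cofactor and Re h ≤ B. Borel–Carathéodory then makes h
small when B is small against R, and `negProd t` is (f / f(0)) exp(-h). -/
theorem norm_negProd_sub_le {f g : ℂ → ℂ} (hg : Differentiable ℂ g) (h0 : f 0 ≠ 0)
    {t : Multiset ℝ} (hfg : ∀ z, f z = negProd t z * g z) {R B : ℝ} (hR : 0 < R)
    (ht : ∀ a ∈ t, 0 < a ∧ a ≤ R) (hne : ∀ z, ‖z‖ ≤ R → g z ≠ 0) (hB : 0 < B)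
    (hM : ∀ z, ‖z‖ = 2 * R → ‖f z‖ ≤ ‖f 0‖ * Real.exp B) {z : ℂ} (hz : ‖z‖ < R)
    (hsmall : 2 * B * ‖z‖ / (R - ‖z‖) ≤ 1) :
    ‖negProd t z - f z / f 0‖ ≤ ‖f z / f 0‖ * (2 * (2 * B * ‖z‖ / (R - ‖z‖))) := by
  have hg0 : g 0 = f 0 := by rw [hfg, negProd_apply_zero, one_mul]
  have hf0 : 0 < ‖f 0‖ := norm_pos_iff.2 h0
  obtain ⟨h, hd, hh0, hexp⟩ := exists_log_on_ball hg hR hne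
  have hbound : MapsTo h (Metric.ball 0 R) {z | z.re ≤ B} := by
    intro w hw
    have hw' : ‖w‖ < R := by simpa using hw
    have h1 := pow_card_mul_norm_le hg hfg le_rfl hR ht (M := ‖f 0‖ * Real.exp B)
      (fun z hz => hM z (by rw [hz]; ring)) (z := w) (by linarith)
    rw [one_pow, one_mul, hexp w hw, hg0, norm_mul, norm_exp] at h1
    exact Real.exp_le_exp.1 (le_of_mul_le_mul_left h1 hf0)
  have hzb : z ∈ Metric.ball (0 : ℂ) R := by simpa using hz
  have hbc := borelCaratheodory_zero hB hd hbound hR hzb hh0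
  have e : negProd t z - f z / f 0 = f z / f 0 * (exp (-h z) - 1) := by
    rw [hfg z, hexp z hzb, hg0, exp_neg]
    have := exp_ne_zero (h z)
    field_simp
  rw [e, norm_mul]
  gcongr
  refine (norm_exp_sub_one_le ?_).trans ?_
  · rw [norm_neg]; exact hbc.trans hsmall
  · rw [norm_neg]; gcongr

/-- An entire function of growth exponent less than `1` with negative zeros is the locally uniform
limit of its finite products over zeros, which may be prescribed to contain a given one. -/
theorem exists_tendsto_negProd {f : ℂ → ℂ} (hf : Differentiable ℂ f) (h0 : f 0 ≠ 0)
    (hneg : HasOnlyNegativeZeros f) {A C σ : ℝ} (hC : 0 < C) (hσ : 0 < σ) (hσ1 : σ < 1)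
    (hup : ∀ z, ‖f z‖ ≤ A * Real.exp (C * ‖z‖ ^ σ)) {s : Multiset ℝ} (hs : ∀ a ∈ s, 0 < a)
    (hd : NegProdDvd s f) :
    ∃ S : ℕ → Multiset ℝ, (∀ n, s ≤ S n) ∧ (∀ n, ∀ a ∈ S n, 0 < a) ∧
      (∀ n, NegProdDvd (S n) f) ∧
      TendstoLocallyUniformlyOn (fun n => negProd (S n)) (fun z => f z / f 0) atTop univ := by
  obtain ⟨R₀, hR₀⟩ : ∃ R₀ : ℝ, ∀ a ∈ s, a ≤ R₀ := by
    obtain ⟨R₀, h⟩ := s.toFinset.bddAbove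
    exact ⟨R₀, fun a ha => h (by simpa using ha)⟩
  have hr : ∀ n : ℕ, 0 < |R₀| + n + 1 := fun n => by positivity
  choose S hsS hS g hg hfg hne using fun n : ℕ => exists_negProd_mul hf h0 hneg (hr n) (s := s)
    (fun a ha => ⟨hs a ha, by
      have := hR₀ a ha
      have := le_abs_self R₀
      have : (0 : ℝ) ≤ n := n.cast_nonneg
      linarith⟩) hd
  refine ⟨S, hsS, fun n a ha => (hS n a ha).1, fun n => ⟨g n, hg n, hfg n⟩, ?_⟩
  have hf0 : 0 < ‖f 0‖ := norm_pos_iff.2 h0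
  have hA0 : ‖f 0‖ ≤ A := by
    have := hup 0
    rwa [norm_zero, Real.zero_rpow hσ.ne', mul_zero, Real.exp_zero, mul_one] at this
  set L := Real.log (A / ‖f 0‖) with hL
  have hL0 : 0 ≤ L := Real.log_nonneg ((one_le_div hf0).2 hA0)
  set B : ℝ → ℝ := fun R => L + C * (2 * R) ^ σ with hBdef
  have hB : ∀ R, 0 < R → 0 < B R := fun R hR => by
    have : 0 < C * (2 * R) ^ σ := by positivity
    simp only [hBdef]; linarith
  have hM : ∀ R, ∀ z : ℂ, ‖z‖ = 2 * R → ‖f z‖ ≤ ‖f 0‖ * Real.exp (B R) := by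
    intro R z hz
    refine (hup z).trans_eq ?_
    rw [hz, hBdef, Real.exp_add, hL, Real.exp_log (div_pos (hf0.trans_le hA0) hf0)]
    field_simp
  -- Here `σ < 1` is essential: the bound on Re h is o(R), so no exponential factor survives in the
  -- limit.
  have hlim : Tendsto (fun R : ℝ => B R / R) atTop (𝓝 0) := by
    have h1 : Tendsto (fun R : ℝ => L / R) atTop (𝓝 0) := tendsto_id.const_div_atTop L
    have h2 : Tendsto (fun R : ℝ => C * 2 ^ σ * R ^ (-(1 - σ))) atTop (𝓝 0) := by
      simpa using (tendsto_rpow_neg_atTop (by linarith : 0 < 1 - σ)).const_mul (C * 2 ^ σ)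
    have h3 := h1.add h2
    rw [add_zero] at h3
    refine h3.congr' ?_
    filter_upwards [eventually_gt_atTop 0] with R hR
    rw [hBdef, add_div, Real.mul_rpow two_pos.le hR.le, neg_sub, Real.rpow_sub_one hR.ne']
    ring
  have hRlim : Tendsto (fun n : ℕ => |R₀| + n + 1) atTop atTop :=
    tendsto_atTop_add_const_right _ _
      (tendsto_atTop_add_const_left _ _ tendsto_natCast_atTop_atTop)
  rw [Metric.tendstoLocallyUniformlyOn_iff]
  intro ε hε x _
  set r := ‖x‖ + 1 with hrdef
  have hr0 : 0 < r := by positivity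
  refine ⟨Metric.ball 0 r, mem_nhdsWithin_of_mem_nhds
    (Metric.isOpen_ball.mem_nhds (by simp [hrdef])), ?_⟩
  obtain ⟨K, hK⟩ := (isCompact_closedBall (0 : ℂ) r).exists_bound_of_continuousOn
    (f := fun z => f z / f 0) (hf.continuous.div_const _).continuousOn
  have hK0 : 0 ≤ K := (norm_nonneg _).trans (hK 0 (by simpa using hr0.le))
  set δ := min 1 (ε / (2 * (K + 1))) with hδ
  have hδ0 : 0 < δ := lt_min one_pos (by positivity)
  have hsm : ∀ᶠ R : ℝ in atTop, B R / R < δ / (4 * r) :=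
    (tendsto_order.1 hlim).2 _ (by positivity)
  filter_upwards [hRlim.eventually hsm, hRlim.eventually_ge_atTop (2 * r)] with n hn1 hn2 y hy
  set R := |R₀| + n + 1 with hRn
  have hR0 : 0 < R := hr n
  have hyr : ‖y‖ < r := by simpa using hy
  have hyR : R / 2 ≤ R - ‖y‖ := by linarith
  have hq : 2 * B R * ‖y‖ / (R - ‖y‖) < δ := by
    have hBR := hB R hR0
    calc 2 * B R * ‖y‖ / (R - ‖y‖) ≤ 2 * B R * r / (R / 2) := by gcongr
      _ = 4 * r * (B R / R) := by field_simp; ring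
      _ < 4 * r * (δ / (4 * r)) := by gcongr
      _ = δ := by field_simp
  have hq1 : 2 * B R * ‖y‖ / (R - ‖y‖) ≤ 1 := hq.le.trans (min_le_left _ _)
  have key := norm_negProd_sub_le (hg n) h0 (hfg n) hR0 (hS n) (hne n) (hB R hR0) (hM R)
    (by linarith) hq1
  rw [dist_comm, dist_eq_norm]
  have hKy := hK y (by simpa using hyr.le)
  have hnn : 0 ≤ 2 * B R * ‖y‖ / (R - ‖y‖) := by
    have := hB R hR0
    exact div_nonneg (by positivity) (by linarith)
  calc _ ≤ _ := key
    _ ≤ K * (2 * δ) := by gcongr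
    _ ≤ K * (2 * (ε / (2 * (K + 1)))) := by gcongr; exact min_le_right _ _
    _ = ε * (K / (K + 1)) := by field_simp
    _ < ε * 1 := by gcongr; rw [div_lt_one (by positivity)]; linarith
    _ = ε := mul_one ε

/-! ### Logarithmic derivatives of the finite products -/

/-- The logarithmic derivative of `negProd s` at a nonnegative real number. -/
noncomputable def recipSum (s : Multiset ℝ) (x : ℝ) : ℝ := (s.map fun a : ℝ => 1 / (x + a)).sum

@[simp] theorem recipSum_empty (x : ℝ) : recipSum 0 x = 0 := by simp [recipSum]

@[simp] theorem recipSum_cons (a : ℝ) (s : Multiset ℝ) (x : ℝ) :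
    recipSum (a ::ₘ s) x = 1 / (x + a) + recipSum s x := by simp [recipSum]

theorem recipSum_nonneg {s : Multiset ℝ} (hs : ∀ a ∈ s, 0 < a) {x : ℝ} (hx : 0 ≤ x) :
    0 ≤ recipSum s x := by
  refine Multiset.sum_nonneg fun b hb => ?_
  obtain ⟨a, ha, rfl⟩ := Multiset.mem_map.1 hb
  have := hs a ha
  positivity

theorem recipSum_mono {s t : Multiset ℝ} (hst : s ≤ t) (ht : ∀ a ∈ t, 0 < a) {x : ℝ}
    (hx : 0 ≤ x) : recipSum s x ≤ recipSum t x := by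
  obtain ⟨u, rfl⟩ := Multiset.le_iff_exists_add.1 hst
  have e : recipSum (s + u) x = recipSum s x + recipSum u x := by simp [recipSum]
  rw [e]
  linarith [recipSum_nonneg (fun a ha => ht a (Multiset.mem_add.2 (Or.inr ha))) hx]

theorem recipSum_antitone {s : Multiset ℝ} (hs : ∀ a ∈ s, 0 < a) {x y : ℝ} (hx : 0 ≤ x)
    (hxy : x ≤ y) : recipSum s y ≤ recipSum s x := by
  induction s using Multiset.induction with
  | empty => simp
  | cons a s ih =>
    have ha := hs a (Multiset.mem_cons_self a s)
    rw [recipSum_cons, recipSum_cons]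
    refine add_le_add ?_ (ih fun a ha => hs a (Multiset.mem_cons_of_mem ha))
    gcongr

theorem one_add_div_ne_zero {a x : ℝ} (ha : 0 < a) (hx : 0 ≤ x) : (1 + x / a : ℂ) ≠ 0 := by
  have : 0 < 1 + x / a := by positivity
  exact_mod_cast this.ne'

theorem negProd_ofReal_ne_zero {s : Multiset ℝ} (hs : ∀ a ∈ s, 0 < a) {x : ℝ} (hx : 0 ≤ x) :
    negProd s x ≠ 0 :=
  norm_pos_iff.1 (one_pos.trans_le (one_le_norm_negProd hs (by simpa using hx)))

theorem logDeriv_negProd {s : Multiset ℝ} (hs : ∀ a ∈ s, 0 < a) {x : ℝ} (hx : 0 ≤ x) :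
    logDeriv (negProd s) x = (recipSum s x : ℝ) := by
  induction s using Multiset.induction with
  | empty => rw [show negProd 0 = fun _ => 1 from funext negProd_empty, logDeriv_const]; simp
  | cons a s ih =>
    have ha := hs a (Multiset.mem_cons_self a s)
    have hs' : ∀ a ∈ s, 0 < a := fun a ha => hs a (Multiset.mem_cons_of_mem ha)
    have hne := one_add_div_ne_zero ha hx
    have hd : HasDerivAt (fun z : ℂ => 1 + z / a) (1 / a) x := by
      simpa using ((hasDerivAt_id (x : ℂ)).div_const (a : ℂ)).const_add 1
    rw [show negProd (a ::ₘ s) = fun z => (1 + z / a) * negProd s z from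
      funext (negProd_cons a s), logDeriv_mul (x : ℂ) hne (negProd_ofReal_ne_zero hs' hx)
      hd.differentiableAt (differentiable_negProd s x), ih hs', recipSum_cons, logDeriv_apply,
      hd.deriv]
    have ha' : (a : ℂ) ≠ 0 := by exact_mod_cast ha.ne'
    have h2 : (x + a : ℂ) ≠ 0 := by
      have : 0 < x + a := by positivity
      exact_mod_cast this.ne'
    have h3 : (a + x : ℂ) ≠ 0 := by rwa [add_comm]
    push_cast
    congr 1
    field_simp
    ring

/-- Factorwise this is log(1 + u) ≥ u / (1 + u) at u = x / a. In the limit it gives (f'/f)(x) the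
decay of log f(x) / x. -/
theorem mul_recipSum_le_log {s : Multiset ℝ} (hs : ∀ a ∈ s, 0 < a) {x : ℝ} (hx : 0 ≤ x) :
    x * recipSum s x ≤ Real.log ‖negProd s x‖ := by
  induction s using Multiset.induction with
  | empty => simp
  | cons a s ih =>
    have ha := hs a (Multiset.mem_cons_self a s)
    have hs' : ∀ a ∈ s, 0 < a := fun a ha => hs a (Multiset.mem_cons_of_mem ha)
    have hne := one_add_div_ne_zero ha hx
    rw [recipSum_cons, negProd_cons, norm_mul, Real.log_mul (norm_ne_zero_iff.2 hne)
      (norm_ne_zero_iff.2 (negProd_ofReal_ne_zero hs' hx)), mul_add]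
    refine add_le_add ?_ (ih hs')
    have e : ‖(1 + x / a : ℂ)‖ = 1 + x / a := by
      have : (1 + x / a : ℂ) = ((1 + x / a : ℝ) : ℂ) := by push_cast; rfl
      rw [this, norm_real, Real.norm_of_nonneg (by positivity)]
    rw [e]
    have h := Real.one_sub_inv_le_log_of_pos (x := 1 + x / a) (by positivity)
    refine le_trans (le_of_eq ?_) h
    have : a + x ≠ 0 := by positivity
    field_simp
    ring

/-! ### Power-weighted integrals and the bound for one factor -/

/-- A power-type bound at infinity gives integrability against `x ^ (-ρ)`. -/
theorem integrableOn_div_rpow {D : ℝ → ℝ} (hD : ContinuousOn D (Ioi 0)) {K σ ρ : ℝ}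
    (hσρ : σ < ρ) (hρ : ρ < 1) (h0 : ∀ x, 0 < x → 0 ≤ D x) (h1 : ∀ x, 0 < x → D x ≤ K)
    (h2 : ∀ x, 1 ≤ x → D x ≤ K * x ^ (σ - 1)) :
    IntegrableOn (fun x => D x / x ^ ρ) (Ioi 0) := by
  have hc : ContinuousOn (fun x : ℝ => D x / x ^ ρ) (Ioi 0) := by
    refine hD.div (fun x hx => ?_) (fun x hx => ?_)
    · exact (Real.continuousAt_rpow_const x ρ (Or.inl (ne_of_gt hx))).continuousWithinAt
    · exact (Real.rpow_pos_of_pos hx ρ).ne'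
  rw [← Ioc_union_Ioi_eq_Ioi zero_le_one, integrableOn_union]
  constructor
  · have hi : IntegrableOn (fun x : ℝ => K * x ^ (-ρ)) (Ioc 0 1) := by
      have := (intervalIntegral.intervalIntegrable_rpow' (a := 0) (b := 1)
        (by linarith : -1 < -ρ)).const_mul K
      rwa [intervalIntegrable_iff_integrableOn_Ioc_of_le zero_le_one] at this
    refine hi.mono' ((hc.mono Ioc_subset_Ioi_self).aestronglyMeasurable measurableSet_Ioc)
      ((ae_restrict_iff' measurableSet_Ioc).2 (ae_of_all _ fun x hx => ?_))
    have hx0 : 0 < x := hx.1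
    have hD0 := h0 x hx0
    rw [Real.norm_of_nonneg (by positivity), Real.rpow_neg hx0.le, div_eq_mul_inv]
    gcongr
    exact h1 x hx0
  · have hi : IntegrableOn (fun x : ℝ => K * x ^ (σ - 1 - ρ)) (Ioi 1) :=
      (integrableOn_Ioi_rpow_of_lt (by linarith : σ - 1 - ρ < -1) one_pos).const_mul K
    refine hi.mono' ((hc.mono (Ioi_subset_Ioi zero_le_one)).aestronglyMeasurable
      measurableSet_Ioi) ((ae_restrict_iff' measurableSet_Ioi).2 (ae_of_all _ fun x hx => ?_))
    have hx1 : 1 < x := hx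
    have hx0 : 0 < x := by linarith
    have hD0 := h0 x hx0
    rw [Real.norm_of_nonneg (by positivity), Real.rpow_sub hx0, ← mul_div_assoc]
    gcongr
    exact h2 x hx1.le

theorem integrableOn_one_div_add_div_rpow {a ρ : ℝ} (ha : 0 < a) (hρ0 : 0 < ρ) (hρ : ρ < 1) :
    IntegrableOn (fun x : ℝ => 1 / (x + a) / x ^ ρ) (Ioi 0) := by
  refine integrableOn_div_rpow (K := max 1 a⁻¹) (σ := 0) ?_ hρ0 hρ (fun x hx => by positivity)
    (fun x hx => ?_) (fun x hx => ?_)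
  · exact continuousOn_const.div (by fun_prop) fun x hx => by
      have hx : (0 : ℝ) < x := hx
      positivity
  · refine le_trans ?_ (le_max_right _ _)
    rw [one_div]
    gcongr
    linarith
  · have hx0 : 0 < x := by linarith
    calc 1 / (x + a) ≤ 1 / x := by gcongr; linarith
      _ = 1 * x ^ (0 - 1 : ℝ) := by rw [zero_sub, Real.rpow_neg_one, one_div, one_mul]
      _ ≤ _ := by gcongr; exact le_max_left _ _

theorem integrableOn_rpow_mul_exp_neg_mul {s r : ℝ} (hs : 0 < s) (hr : 0 < r) :
    IntegrableOn (fun t : ℝ => t ^ (s - 1) * Real.exp (-(r * t))) (Ioi 0) := by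
  refine Integrable.of_integral_ne_zero ?_
  rw [Real.integral_rpow_mul_exp_neg_mul_Ioi hs hr]
  exact (mul_pos (by positivity) (Real.Gamma_pos_of_pos hs)).ne'

/-- The Stieltjes transform of a power. -/
theorem integral_one_div_add_div_rpow {a ρ : ℝ} (ha : 0 < a) (hρ0 : 0 < ρ) (hρ : ρ < 1) :
    ∫ x in Ioi (0 : ℝ), 1 / (x + a) / x ^ ρ = a ^ (-ρ) * Real.Gamma ρ * Real.Gamma (1 - ρ) := by
  have hG := Real.Gamma_pos_of_pos hρ0
  have hG1 := Real.Gamma_pos_of_pos (by linarith : 0 < 1 - ρ)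
  have hm : Measurable (Function.uncurry fun x t : ℝ =>
      ENNReal.ofReal (x ^ (1 - ρ - 1) * Real.exp (-(t * x)) * Real.exp (-(a * t)))) := by
    unfold Function.uncurry; fun_prop
  -- Write 1/(x + a) = ∫₀^∞ exp(-(x + a) t) dt and exchange by Tonelli; both remaining integrals are
  -- Gamma integrals.
  have key : ∫⁻ x in Ioi (0 : ℝ), ENNReal.ofReal (1 / (x + a) / x ^ ρ) =
      ENNReal.ofReal (a ^ (-ρ) * Real.Gamma ρ * Real.Gamma (1 - ρ)) := by
    calc _ = ∫⁻ x in Ioi (0 : ℝ), ∫⁻ t in Ioi (0 : ℝ),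
          ENNReal.ofReal (x ^ (1 - ρ - 1) * Real.exp (-(t * x)) * Real.exp (-(a * t))) := by
          refine setLIntegral_congr_fun measurableSet_Ioi fun x hx => ?_
          have hx : (0 : ℝ) < x := hx
          have e : ∀ t : ℝ, x ^ (1 - ρ - 1) * Real.exp (-(t * x)) * Real.exp (-(a * t)) =
              x ^ (-ρ) * Real.exp (-(x + a) * t) := fun t => by
            rw [mul_assoc, ← Real.exp_add]; ring_nf
          have hn : -(x + a) < 0 := by linarith
          simp only [e]
          rw [← ofReal_integral_eq_lintegral_ofReal
            ((integrableOn_exp_mul_Ioi hn 0).const_mul _) (ae_of_all _ fun t => by positivity),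
            integral_const_mul, integral_exp_mul_Ioi hn]
          congr 1
          rw [mul_zero, Real.exp_zero, Real.rpow_neg hx.le, neg_div_neg_eq]
          ring
      _ = ∫⁻ t in Ioi (0 : ℝ), ∫⁻ x in Ioi (0 : ℝ),
          ENNReal.ofReal (x ^ (1 - ρ - 1) * Real.exp (-(t * x)) * Real.exp (-(a * t))) :=
          lintegral_lintegral_swap hm.aemeasurable
      _ = ∫⁻ t in Ioi (0 : ℝ), ENNReal.ofReal (Real.Gamma (1 - ρ) *
            (t ^ (ρ - 1) * Real.exp (-(a * t)))) := by
          refine setLIntegral_congr_fun measurableSet_Ioi fun t ht => ?_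
          have ht : (0 : ℝ) < t := ht
          have hs : 0 < 1 - ρ := by linarith
          rw [← ofReal_integral_eq_lintegral_ofReal
            ((integrableOn_rpow_mul_exp_neg_mul hs ht).mul_const _)
            ((ae_restrict_iff' measurableSet_Ioi).2 (ae_of_all _ fun x hx => by
              have hx : (0 : ℝ) < x := hx
              positivity)),
            integral_mul_const, Real.integral_rpow_mul_exp_neg_mul_Ioi hs ht]
          congr 1
          rw [one_div, Real.inv_rpow ht.le, ← Real.rpow_neg ht.le, neg_sub]
          ring
      _ = _ := by
          rw [← ofReal_integral_eq_lintegral_ofReal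
            ((integrableOn_rpow_mul_exp_neg_mul hρ0 ha).const_mul _)
            ((ae_restrict_iff' measurableSet_Ioi).2 (ae_of_all _ fun x hx => by
              have hx : (0 : ℝ) < x := hx
              positivity)),
            integral_const_mul, Real.integral_rpow_mul_exp_neg_mul_Ioi hρ0 ha]
          congr 1
          rw [one_div, Real.inv_rpow ha.le, ← Real.rpow_neg ha.le]
          ring
  rw [integral_eq_lintegral_of_nonneg_ae ((ae_restrict_iff' measurableSet_Ioi).2
    (ae_of_all _ fun x hx => by
      have hx : (0 : ℝ) < x := hx
      simp only [Pi.zero_apply]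
      positivity)) (integrableOn_one_div_add_div_rpow ha hρ0 hρ).aestronglyMeasurable, key,
    ENNReal.toReal_ofReal (by positivity)]

/-- The maximum of t^ρ exp(-t) is attained at t = ρ; this is where the constant (ρ/e)^ρ originates.
-/
theorem exp_neg_le_rpow {ρ t : ℝ} (hρ : 0 < ρ) (ht : 0 < t) :
    Real.exp (-t) ≤ (ρ / Real.exp 1) ^ ρ * t ^ (-ρ) := by
  have h := Real.log_le_sub_one_of_pos (div_pos ht hρ)
  rw [Real.log_div ht.ne' hρ.ne'] at h
  have h2 : ρ * (Real.log t - Real.log ρ) ≤ t - ρ := by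
    refine (mul_le_mul_of_nonneg_left h hρ.le).trans_eq ?_
    field_simp
  rw [Real.rpow_def_of_pos (by positivity), Real.rpow_def_of_pos ht, ← Real.exp_add,
    Real.log_div hρ.ne' (Real.exp_pos 1).ne', Real.log_exp]
  exact Real.exp_le_exp.2 (by nlinarith)

/-- Multiply the bound on exp(-t) by exp(-u t) and integrate over t. A further integration in u
gives the bound on log(1 + u). -/
theorem one_div_one_add_le {ρ u : ℝ} (hρ0 : 0 < ρ) (hρ : ρ < 1) (hu : 0 < u) :
    1 / (1 + u) ≤ (ρ / Real.exp 1) ^ ρ * Real.Gamma (1 - ρ) * u ^ (ρ - 1) := by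
  have hs : 0 < 1 - ρ := by linarith
  have hn : -(1 + u) < 0 := by linarith
  have hi := (integrableOn_rpow_mul_exp_neg_mul hs hu).const_mul ((ρ / Real.exp 1) ^ ρ)
  have h := setIntegral_mono_on (integrableOn_exp_mul_Ioi hn 0) hi measurableSet_Ioi
    (fun t ht => by
      have ht : (0 : ℝ) < t := ht
      have h1 := exp_neg_le_rpow hρ0 ht
      have e : Real.exp (-(1 + u) * t) = Real.exp (-t) * Real.exp (-(u * t)) := by
        rw [← Real.exp_add]; ring_nf
      rw [e, show 1 - ρ - 1 = -ρ by ring, ← mul_assoc]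
      gcongr)
  rw [integral_exp_mul_Ioi hn, integral_const_mul, Real.integral_rpow_mul_exp_neg_mul_Ioi hs hu,
    one_div u, Real.inv_rpow hu.le, ← Real.rpow_neg hu.le, neg_sub, mul_zero, Real.exp_zero,
    neg_div_neg_eq] at h
  linarith

theorem log_one_add_le_rpow {ρ u : ℝ} (hρ0 : 0 < ρ) (hρ : ρ < 1) (hu : 0 ≤ u) :
    Real.log (1 + u) ≤ (ρ / Real.exp 1) ^ ρ * Real.Gamma (1 - ρ) / ρ * u ^ ρ := by
  set c := (ρ / Real.exp 1) ^ ρ * Real.Gamma (1 - ρ) with hc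
  have hcont : ContinuousOn (fun u : ℝ => c / ρ * u ^ ρ - Real.log (1 + u)) (Ici 0) := by
    refine ContinuousOn.sub ?_ ?_
    · exact (continuous_const.mul (Real.continuous_rpow_const hρ0.le)).continuousOn
    · refine ContinuousOn.log (by fun_prop) fun x hx => ?_
      have hx : (0 : ℝ) ≤ x := hx
      positivity
  have hder : ∀ x : ℝ, 0 < x → HasDerivAt (fun u : ℝ => c / ρ * u ^ ρ - Real.log (1 + u))
      (c * x ^ (ρ - 1) - 1 / (1 + x)) x := by
    intro x hx
    have h1 := (Real.hasDerivAt_rpow_const (p := ρ) (Or.inl hx.ne')).const_mul (c / ρ)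
    have h2 : HasDerivAt (fun u : ℝ => Real.log (1 + u)) (1 / (1 + x)) x :=
      ((hasDerivAt_id x).const_add 1).log (by simp only [id]; positivity)
    refine (h1.sub h2).congr_deriv ?_
    rw [← mul_assoc, div_mul_cancel₀ _ hρ0.ne']
  have hmono := monotoneOn_of_deriv_nonneg (convex_Ici (0 : ℝ)) hcont
    (fun x hx => by
      rw [interior_Ici] at hx
      exact (hder x hx).differentiableAt.differentiableWithinAt)
    (fun x hx => by
      rw [interior_Ici] at hx
      rw [(hder x hx).deriv]
      linarith [one_div_one_add_le hρ0 hρ hx])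
  have := hmono self_mem_Ici hu hu
  simp only [Real.zero_rpow hρ0.ne', mul_zero, add_zero, Real.log_one, sub_zero] at this
  linarith

/-- Bernoulli's inequality (1 + |w|)^c ≤ 1 + c|w| brings in the parameter c. Any c in (0, 1] is
admissible; c = cos(arg z) is chosen only at the end. -/
theorem log_norm_one_add_le {ρ c : ℝ} (hρ0 : 0 < ρ) (hρ : ρ < 1) (hc : 0 < c) (hc1 : c ≤ 1)
    {w : ℂ} (hw : 1 + w ≠ 0) :
    Real.log ‖1 + w‖ ≤ (ρ / Real.exp 1) ^ ρ * Real.Gamma (1 - ρ) / ρ * c ^ (ρ - 1) * ‖w‖ ^ ρ := by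
  have h1 : ‖1 + w‖ ≤ 1 + ‖w‖ := (norm_add_le _ _).trans_eq (by rw [norm_one])
  have h2 : c * Real.log ‖1 + w‖ ≤ Real.log (1 + c * ‖w‖) := by
    calc c * Real.log ‖1 + w‖ ≤ c * Real.log (1 + ‖w‖) := by
          gcongr
      _ = Real.log ((1 + ‖w‖) ^ c) := (Real.log_rpow (by positivity) c).symm
      _ ≤ _ := Real.log_le_log (by positivity) (rpow_one_add_le_one_add_mul_self
          (by linarith [norm_nonneg w]) hc.le hc1)
  have h3 := h2.trans (log_one_add_le_rpow hρ0 hρ (by positivity))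
  rw [Real.mul_rpow hc.le (norm_nonneg w)] at h3
  rw [Real.rpow_sub_one hc.ne']
  rw [mul_comm, ← le_div_iff₀ hc] at h3
  refine h3.trans_eq ?_
  ring

/-- The factor a^(-ρ) from |z/a|^ρ is rewritten as a Stieltjes integral. The bound then becomes
linear in 1/(x + a) and can be summed over the zeros. -/
theorem log_norm_one_add_div_le {ρ c a : ℝ} (hρ0 : 0 < ρ) (hρ : ρ < 1) (hc : 0 < c)
    (hc1 : c ≤ 1) (ha : 0 < a) {z : ℂ} (hz : 1 + z / a ≠ 0) :
    Real.log ‖1 + z / a‖ ≤ (ρ / Real.exp 1) ^ ρ / (c ^ (1 - ρ) * Real.Gamma (1 + ρ)) *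
      ‖z‖ ^ ρ * ∫ x in Ioi (0 : ℝ), 1 / (x + a) / x ^ ρ := by
  refine (log_norm_one_add_le hρ0 hρ hc hc1 hz).trans_eq ?_
  have hG := (Real.Gamma_pos_of_pos hρ0).ne'
  rw [integral_one_div_add_div_rpow ha hρ0 hρ, add_comm 1 ρ, Real.Gamma_add_one hρ0.ne',
    norm_div, norm_real, Real.norm_of_nonneg ha.le, Real.div_rpow (norm_nonneg z) ha.le,
    Real.rpow_neg ha.le, ← neg_sub 1 ρ, Real.rpow_neg hc.le]
  field_simp

theorem recipSum_div_rpow {s : Multiset ℝ} (hs : ∀ a ∈ s, 0 < a) {ρ c : ℝ} (hρ0 : 0 < ρ)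
    (hρ : ρ < 1) (hc : 0 < c) (hc1 : c ≤ 1) {z : ℂ} (hz : 0 ≤ z.re) :
    IntegrableOn (fun x => recipSum s x / x ^ ρ) (Ioi 0) ∧
    Real.log ‖negProd s z‖ ≤ (ρ / Real.exp 1) ^ ρ / (c ^ (1 - ρ) * Real.Gamma (1 + ρ)) *
      ‖z‖ ^ ρ * ∫ x in Ioi (0 : ℝ), recipSum s x / x ^ ρ := by
  induction s using Multiset.induction with
  | empty => simp
  | cons a s ih =>
    have ha := hs a (Multiset.mem_cons_self a s)
    have hs' : ∀ a ∈ s, 0 < a := fun a ha => hs a (Multiset.mem_cons_of_mem ha)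
    obtain ⟨hi, hl⟩ := ih hs'
    have hn1 : ‖1 + z / (a : ℂ)‖ ≠ 0 := (one_pos.trans_le (one_le_norm_one_add_div ha hz)).ne'
    have hn2 : ‖negProd s z‖ ≠ 0 := (one_pos.trans_le (one_le_norm_negProd hs' hz)).ne'
    have hia := integrableOn_one_div_add_div_rpow ha hρ0 hρ
    have e : (fun x => recipSum (a ::ₘ s) x / x ^ ρ) =
        fun x => 1 / (x + a) / x ^ ρ + recipSum s x / x ^ ρ := by
      ext x; rw [recipSum_cons, add_div]
    rw [e]
    refine ⟨hia.add hi, ?_⟩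
    rw [integral_add hia hi, mul_add, negProd_cons, norm_mul, Real.log_mul hn1 hn2]
    exact add_le_add (log_norm_one_add_div_le hρ0 hρ hc hc1 ha (norm_ne_zero_iff.1 hn1)) hl

/-! ### Passage to the limit over the zeros -/

theorem negProdDvd_empty {f : ℂ → ℂ} (hf : Differentiable ℂ f) : NegProdDvd 0 f :=
  ⟨f, hf, fun z => by rw [negProd_empty, one_mul]⟩

theorem HasOnlyNegativeZeros.ofReal_ne_zero {f : ℂ → ℂ} (h : HasOnlyNegativeZeros f) {x : ℝ}
    (hx : 0 ≤ x) : f x ≠ 0 := fun h0 => by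
  have := (h x h0).2
  rw [ofReal_re] at this
  linarith

theorem tendsto_recipSum {f : ℂ → ℂ} (hneg : HasOnlyNegativeZeros f)
    {S : ℕ → Multiset ℝ} (hS : ∀ n, ∀ a ∈ S n, 0 < a)
    (hT : TendstoLocallyUniformlyOn (fun n => negProd (S n)) (fun z => f z / f 0) atTop univ)
    {x : ℝ} (hx : 0 ≤ x) :
    Tendsto (fun n => recipSum (S n) x) atTop (𝓝 (logDeriv f x).re) := by
  have h0 : f 0 ≠ 0 := by simpa using hneg.ofReal_ne_zero le_rfl
  have h := logDeriv_tendsto isOpen_univ (mem_univ (x : ℂ)) hT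
    (Eventually.of_forall fun n => (differentiable_negProd (S n)).differentiableOn)
    (div_ne_zero (hneg.ofReal_ne_zero hx) h0)
  have e : logDeriv (fun z => f z / f 0) (x : ℂ) = logDeriv f x := by
    simp only [div_eq_mul_inv]
    exact logDeriv_mul_const (x : ℂ) _ (inv_ne_zero h0)
  rw [e] at h
  simp only [logDeriv_negProd (hS _) hx] at h
  exact (continuous_re.tendsto _).comp h

/-- Bounds of the logarithmic derivative on the positive half-line, and the lower bound in the right
half-plane, for an entire function of growth exponent less than `1` with negative zeros. -/
theorem logDeriv_bounds {f : ℂ → ℂ} (hf : Differentiable ℂ f) (hneg : HasOnlyNegativeZeros f)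
    {A C σ : ℝ} (hC : 0 < C) (hσ : 0 < σ) (hσ1 : σ < 1)
    (hup : ∀ z, ‖f z‖ ≤ A * Real.exp (C * ‖z‖ ^ σ)) :
    (∀ x : ℝ, 0 ≤ x → 0 ≤ (logDeriv f x).re ∧ (logDeriv f x).re ≤ (logDeriv f 0).re ∧
      x * (logDeriv f x).re ≤ Real.log ‖f x / f 0‖) ∧
    ∀ z : ℂ, 0 ≤ z.re → ‖f 0‖ ≤ ‖f z‖ := by
  have h0 : f 0 ≠ 0 := by simpa using hneg.ofReal_ne_zero le_rfl
  obtain ⟨S, -, hS, -, hT⟩ := exists_tendsto_negProd hf h0 hneg hC hσ hσ1 hup (s := 0) (by simp)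
    (negProdDvd_empty hf)
  have hpt : ∀ z, Tendsto (fun n => negProd (S n) z) atTop (𝓝 (f z / f 0)) := fun z =>
    hT.tendsto_at (mem_univ z)
  refine ⟨fun x hx => ?_, fun z hz => ?_⟩
  · have ht := tendsto_recipSum hneg hS hT hx
    refine ⟨ge_of_tendsto' ht fun n => recipSum_nonneg (hS n) hx, ?_, ?_⟩
    · have ht0 := tendsto_recipSum hneg hS hT le_rfl
      rw [ofReal_zero] at ht0
      exact le_of_tendsto_of_tendsto' ht ht0 fun n => recipSum_antitone (hS n) le_rfl hx
    · exact le_of_tendsto_of_tendsto' (ht.const_mul x) ((hpt x).norm.log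
        (norm_ne_zero_iff.2 (div_ne_zero (hneg.ofReal_ne_zero hx) h0)))
        fun n => mul_recipSum_le_log (hS n) hx
  · have := ge_of_tendsto' (hpt z).norm fun n => one_le_norm_negProd (hS n) hz
    rwa [norm_div, one_le_div (norm_pos_iff.2 h0)] at this

/-- The approximating products are rebuilt so that all of them contain `s`; their sums then dominate
`recipSum s`, and so does the limit. The products of a fixed approximating sequence need not be
nested, hence the prescribed part in `exists_tendsto_negProd`. -/
theorem recipSum_le_logDeriv {f : ℂ → ℂ} (hf : Differentiable ℂ f) (hneg : HasOnlyNegativeZeros f)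
    {A C σ : ℝ} (hC : 0 < C) (hσ : 0 < σ) (hσ1 : σ < 1)
    (hup : ∀ z, ‖f z‖ ≤ A * Real.exp (C * ‖z‖ ^ σ)) {s : Multiset ℝ} (hs : ∀ a ∈ s, 0 < a)
    (hd : NegProdDvd s f) {x : ℝ} (hx : 0 ≤ x) : recipSum s x ≤ (logDeriv f x).re := by
  have h0 : f 0 ≠ 0 := by simpa using hneg.ofReal_ne_zero le_rfl
  obtain ⟨S, hsS, hS, -, hT⟩ := exists_tendsto_negProd hf h0 hneg hC hσ hσ1 hup hs hd
  exact ge_of_tendsto' (tendsto_recipSum hneg hS hT hx) fun n =>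
    recipSum_mono (hsS n) (hS n) hx

theorem continuousOn_logDeriv_re {f : ℂ → ℂ} (hf : Differentiable ℂ f)
    (hneg : HasOnlyNegativeZeros f) :
    ContinuousOn (fun x : ℝ => (logDeriv f x).re) (Ioi 0) := by
  refine continuous_re.comp_continuousOn (ContinuousOn.div ?_ ?_ fun x hx =>
    hneg.ofReal_ne_zero (le_of_lt hx))
  · exact (hf.deriv.continuous.comp continuous_ofReal).continuousOn
  · exact (hf.continuous.comp continuous_ofReal).continuousOn

theorem integrableOn_logDeriv_div_rpow {f : ℂ → ℂ} (hf : Differentiable ℂ f)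
    (hneg : HasOnlyNegativeZeros f) {A C σ ρ : ℝ} (hC : 0 < C) (hσ : 0 < σ) (hσρ : σ < ρ)
    (hρ : ρ < 1) (hup : ∀ z, ‖f z‖ ≤ A * Real.exp (C * ‖z‖ ^ σ)) :
    IntegrableOn (fun x : ℝ => (logDeriv f x).re / x ^ ρ) (Ioi 0) := by
  have h0 : 0 < ‖f 0‖ := norm_pos_iff.2 (by simpa using hneg.ofReal_ne_zero le_rfl)
  obtain ⟨hb, -⟩ := logDeriv_bounds hf hneg hC hσ (hσρ.trans hρ) hup
  have hA0 : ‖f 0‖ ≤ A := by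
    have := hup 0
    rwa [norm_zero, Real.zero_rpow hσ.ne', mul_zero, Real.exp_zero, mul_one] at this
  have hA : 0 < A / ‖f 0‖ := div_pos (h0.trans_le hA0) h0
  set L := Real.log (A / ‖f 0‖) with hL
  have hL0 : 0 ≤ L := Real.log_nonneg ((one_le_div h0).2 hA0)
  refine integrableOn_div_rpow (K := max (logDeriv f 0).re (L + C)) (σ := σ)
    (continuousOn_logDeriv_re hf hneg) hσρ hρ (fun x hx => (hb x hx.le).1)
    (fun x hx => ((hb x hx.le).2.1).trans (le_max_left _ _)) fun x hx => ?_
  have hx0 : 0 < x := by linarith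
  have hx1 : 1 ≤ x ^ σ := Real.one_le_rpow hx hσ.le
  have h1 : Real.log ‖f x / f 0‖ ≤ L + C * x ^ σ := by
    have h2 := hup x
    rw [norm_real, Real.norm_of_nonneg hx0.le] at h2
    have h3 : ‖f x / f 0‖ ≤ A / ‖f 0‖ * Real.exp (C * x ^ σ) := by
      rw [norm_div, div_mul_eq_mul_div]
      gcongr
    refine (Real.log_le_log (norm_pos_iff.2 (div_ne_zero (hneg.ofReal_ne_zero hx0.le)
      (norm_pos_iff.1 h0))) h3).trans_eq ?_
    rw [Real.log_mul hA.ne' (Real.exp_pos _).ne', Real.log_exp]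
  have h4 : x * (logDeriv f x).re ≤ (L + C) * x ^ σ := by
    have := (hb x hx0.le).2.2
    nlinarith
  rw [Real.rpow_sub_one hx0.ne', ← mul_div_assoc, le_div_iff₀ hx0, mul_comm]
  refine h4.trans ?_
  gcongr
  exact le_max_right _ _

/-- The upper bound in the right half-plane through the logarithmic derivative on the positive
half-line. -/
theorem norm_le_exp_integral_logDeriv {f : ℂ → ℂ} (hf : Differentiable ℂ f)
    (hneg : HasOnlyNegativeZeros f) {A C σ ρ : ℝ} (hC : 0 < C) (hσ : 0 < σ) (hσρ : σ < ρ)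
    (hρ : ρ < 1) (hup : ∀ z, ‖f z‖ ≤ A * Real.exp (C * ‖z‖ ^ σ)) {c : ℝ} (hc : 0 < c)
    (hc1 : c ≤ 1) {z : ℂ} (hz : 0 ≤ z.re) :
    ‖f z‖ ≤ ‖f 0‖ * Real.exp ((ρ / Real.exp 1) ^ ρ / (c ^ (1 - ρ) * Real.Gamma (1 + ρ)) *
      ‖z‖ ^ ρ * ∫ x in Ioi (0 : ℝ), (logDeriv f x).re / x ^ ρ) := by
  have h0 : f 0 ≠ 0 := by simpa using hneg.ofReal_ne_zero le_rfl
  have hρ0 : 0 < ρ := hσ.trans hσρ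
  obtain ⟨S, -, hS, hd, hT⟩ := exists_tendsto_negProd hf h0 hneg hC hσ (hσρ.trans hρ) hup
    (s := 0) (by simp) (negProdDvd_empty hf)
  have hi := integrableOn_logDeriv_div_rpow hf hneg hC hσ hσρ hρ hup
  have hlim := (hT.tendsto_at (mem_univ z)).norm
  have := le_of_tendsto' hlim (b := Real.exp ((ρ / Real.exp 1) ^ ρ /
    (c ^ (1 - ρ) * Real.Gamma (1 + ρ)) * ‖z‖ ^ ρ *
      ∫ x in Ioi (0 : ℝ), (logDeriv f x).re / x ^ ρ)) fun n => by
    obtain ⟨hin, hl⟩ := recipSum_div_rpow (hS n) hρ0 hρ hc hc1 hz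
    rw [← Real.log_le_iff_le_exp (one_pos.trans_le (one_le_norm_negProd (hS n) hz))]
    refine hl.trans ?_
    have hG := Real.Gamma_pos_of_pos (by linarith : 0 < 1 + ρ)
    refine mul_le_mul_of_nonneg_left ?_ (by positivity)
    -- Domination of each finite sum by f'/f replaces a convergence theorem for the integrals.
    refine setIntegral_mono_on hin hi measurableSet_Ioi fun x hx => ?_
    have hx : (0 : ℝ) < x := hx
    have := recipSum_le_logDeriv hf hneg hC hσ (hσρ.trans hρ) hup (hS n) (hd n) hx.le
    gcongr
  rwa [norm_div, div_le_iff₀ (norm_pos_iff.2 h0), mul_comm] at this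

/-! ### Application to the Airy product -/

theorem airyProduct_ofReal {t : ℝ} (ht : 0 ≤ t) :
    airyProduct t = ((‖airyAi (I * (√t : ℝ))‖ ^ 2 : ℝ) : ℂ) := by
  rw [airyProduct_eq (w := I * (√t : ℝ)), airyAi_neg_I_mul, star_def, mul_conj,
    normSq_eq_norm_sq]
  rw [mul_pow, I_sq, ← ofReal_pow, Real.sq_sqrt ht, neg_one_mul]

/-- On the positive axis f = |Ai(i√x)|² > 0, so the function is half of Re log f there. The
resulting 1/2 cancels the 2 in `airyBound`. -/
theorem hasDerivAt_log_norm_airyAi {x : ℝ} (hx : 0 < x) :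
    HasDerivAt (fun t : ℝ => Real.log ‖airyAi (I * ((√t : ℝ) : ℂ))‖)
      (1 / 2 * (logDeriv airyProduct x).re) x := by
  have hne : ∀ t : ℝ, 0 < t → 0 < ‖airyAi (I * (√t : ℝ))‖ := fun t ht =>
    norm_pos_iff.2 (airyAi_I_mul_ne_zero (Real.sqrt_pos.2 ht))
  have hslit : airyProduct x ∈ slitPlane := by
    rw [airyProduct_ofReal hx.le, ofReal_mem_slitPlane]
    exact pow_pos (hne x hx) 2
  have hd : HasDerivAt (fun t : ℝ => airyProduct t) (deriv airyProduct x) x :=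
    (differentiable_airyProduct x).hasDerivAt.comp_ofReal
  have hl := ((reCLM.hasFDerivAt.comp_hasDerivAt x (hd.clog_real hslit))).const_mul (1 / 2 : ℝ)
  refine (hl.congr_of_eventuallyEq ?_).congr_deriv rfl
  filter_upwards [lt_mem_nhds hx] with t ht
  simp only [Function.comp_apply, reCLM_apply, log_re]
  rw [airyProduct_ofReal ht.le, norm_real, norm_pow, norm_norm, Real.log_pow]
  push_cast
  ring

theorem airyBound_eq (ρ : ℝ) (z : ℂ) :
    airyBound ρ z = (ρ / Real.exp 1) ^ ρ / (Real.cos z.arg ^ (1 - ρ) * Real.Gamma (1 + ρ)) *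
      ∫ x in Ioi (0 : ℝ), (logDeriv airyProduct x).re / x ^ ρ := by
  have e : ∫ x in Ioi (0 : ℝ),
      deriv (fun t : ℝ => Real.log ‖airyAi (I * ((Real.sqrt t : ℝ) : ℂ))‖) x / x ^ ρ =
      ∫ x in Ioi (0 : ℝ), 1 / 2 * ((logDeriv airyProduct x).re / x ^ ρ) := by
    refine setIntegral_congr_fun measurableSet_Ioi fun x hx => ?_
    simp only [(hasDerivAt_log_norm_airyAi hx).deriv, mul_div_assoc]
  rw [airyBound, e, integral_const_mul]
  ring

theorem norm_airyProduct_zero :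
    ‖airyProduct 0‖ = 1 / ((3 : ℝ) ^ (4 / 3 : ℝ) * Real.Gamma (2 / 3) ^ 2) := by
  rw [airyProduct_zero, airyAi_zero_sq, norm_real, Real.norm_of_nonneg (by positivity)]

theorem mainTheorem3 :
    -- `Ai` is entire of order `3/2` with only negative zeros
    (Differentiable ℂ airyAi ∧ entireOrder airyAi = ((3 / 2 : ℝ) : EReal) ∧
      HasOnlyNegativeZeros airyAi) ∧
    -- `Ai(z) Ai(-z)` is an even entire function of order `3/2` with only real zeros
    ((∀ z : ℂ, airyAi (-z) * airyAi (-(-z)) = airyAi z * airyAi (-z)) ∧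
      Differentiable ℂ (fun z => airyAi z * airyAi (-z)) ∧
      entireOrder (fun z => airyAi z * airyAi (-z)) = ((3 / 2 : ℝ) : EReal) ∧
      ∀ z : ℂ, airyAi z * airyAi (-z) = 0 → z.im = 0) ∧
    -- `f(z) = Ai(i√z) Ai(-i√z)` is entire of order `3/4` with only negative zeros
    (Differentiable ℂ airyProduct ∧ entireOrder airyProduct = ((3 / 4 : ℝ) : EReal) ∧
      HasOnlyNegativeZeros airyProduct) ∧
    -- the value at the origin
    (airyProduct 0 = airyAi 0 ^ 2 ∧
      airyAi 0 ^ 2 = ((1 / ((3 : ℝ) ^ (4 / 3 : ℝ) * Real.Gamma (2 / 3) ^ 2) : ℝ) : ℂ)) ∧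
    -- the integrand of `b_ρ` makes sense
    DifferentiableOn ℝ (fun t : ℝ => Real.log ‖airyAi (I * ((Real.sqrt t : ℝ) : ℂ))‖) (Ioi 0) ∧
    (∀ x : ℝ, 0 < x → airyAi (I * ((Real.sqrt x : ℝ) : ℂ)) ≠ 0) ∧
    ∀ ρ : ℝ, 3 / 4 < ρ → ρ < 1 →
      IntegrableOn (fun x : ℝ =>
        deriv (fun t : ℝ => Real.log ‖airyAi (I * ((Real.sqrt t : ℝ) : ℂ))‖) x / x ^ ρ) (Ioi 0) ∧
      ∀ z : ℂ, |z.arg| < Real.pi / 2 →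
        1 / ((3 : ℝ) ^ (4 / 3 : ℝ) * Real.Gamma (2 / 3) ^ 2)
            ≤ ‖airyAi (I * Complex.sqrt z) * airyAi (-(I * Complex.sqrt z))‖ ∧
        ‖airyAi (I * Complex.sqrt z) * airyAi (-(I * Complex.sqrt z))‖
            ≤ Real.exp (airyBound ρ z * ‖z‖ ^ ρ) /
                ((3 : ℝ) ^ (4 / 3 : ℝ) * Real.Gamma (2 / 3) ^ 2) := by 
  have hI : ∀ x : ℝ, 0 < x → airyAi (I * ((Real.sqrt x : ℝ) : ℂ)) ≠ 0 := fun x hx =>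
    airyAi_I_mul_ne_zero (Real.sqrt_pos.2 hx)
  refine ⟨⟨differentiable_airyAi, entireOrder_airyAi, hasOnlyNegativeZeros_airyAi⟩,
    ⟨fun z => by rw [neg_neg, mul_comm], differentiable_airyAi_mul_neg,
      entireOrder_airyAi_mul_neg, fun z hz => ?_⟩,
    ⟨differentiable_airyProduct, entireOrder_airyProduct, hasOnlyNegativeZeros_airyProduct⟩,
    ⟨airyProduct_zero, airyAi_zero_sq⟩,
    fun x hx => (hasDerivAt_log_norm_airyAi hx).differentiableAt.differentiableWithinAt, hI,
    fun ρ hρ hρ1 => ⟨?_, fun z hz => ?_⟩⟩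
  · rcases mul_eq_zero.1 hz with h | h
    · exact (hasOnlyNegativeZeros_airyAi z h).1
    · simpa using (hasOnlyNegativeZeros_airyAi (-z) h).1
  · have := (integrableOn_logDeriv_div_rpow differentiable_airyProduct
      hasOnlyNegativeZeros_airyProduct (by norm_num) (by norm_num) hρ hρ1
      norm_airyProduct_le).const_mul (1 / 2)
    refine IntegrableOn.congr_fun this (fun x hx => ?_) measurableSet_Ioi
    simp only [(hasDerivAt_log_norm_airyAi hx).deriv, mul_div_assoc]
  · have hcos : 0 < Real.cos z.arg :=
      Real.cos_pos_of_mem_Ioo ⟨by linarith [(abs_lt.1 hz).1], (abs_lt.1 hz).2⟩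
    have hre : 0 ≤ z.re := by
      rw [← norm_mul_cos_arg z]
      positivity
    change _ ≤ ‖airyProduct z‖ ∧ ‖airyProduct z‖ ≤ _
    have hlow := (logDeriv_bounds differentiable_airyProduct hasOnlyNegativeZeros_airyProduct
      (by norm_num) (by norm_num) (by norm_num) norm_airyProduct_le).2 z hre
    -- The free parameter `c` is taken to be `Real.cos z.arg`.
    have hupp := norm_le_exp_integral_logDeriv differentiable_airyProduct
      hasOnlyNegativeZeros_airyProduct (by norm_num) (by norm_num) hρ hρ1 norm_airyProduct_le
      hcos (Real.cos_le_one _) hre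
    rw [norm_airyProduct_zero] at hlow hupp
    refine ⟨hlow, hupp.trans_eq ?_⟩
    rw [airyBound_eq, one_div, inv_mul_eq_div, mul_right_comm (_ / _)]
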